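/- All graphs are finite, undirected and loopless; parallel edges are allowed. For a graph $H$ and $W\subseteq V(H)$ let $\delta(W)$ be the set of edges with exactly one endpoint in $W$; for a partition $\mathcal W$ of $V(H)$ let $\delta(\mathcal W)=\bigcup_{W\in\mathcal W}\delta(W)$; and for $x\in\mathbb R^{E(H)}$ and $S\subseteq E(H)$ let $x(S)=\sum_{e\in S}x_e$. For $T\subseteq V(H)$ with $|T|$ even, a $T$-join in $H$ is a set $F\subseteq E(H)$ with $T=\{v\in V(H): |\delta(\{v\})\cap F|\text{ odd}\}$. Let $2G$ be the graph arising from $G$ by doubling all its edges. A connected-$T$-join of $G$ is a $T$-join $F$ in $2G$ such that $(V(G),F)$ is connected. Let $$P(H,T)=\bigl\{x\in\mathbb R_{\ge0}^{E(H)}: x(\delta(W))\ge 2 \text{ for all } \emptyset\ne W\subsetneq V(H)\text{ with }|W\cap T|\text{ even},\ x(\delta(\mathcal W))\ge|\mathcal W|-1\text{ for all partitions }\mathcal W\text{ of }V(H)\bigr\},$$ $$Q(H,T)=\bigl\{x\in[0,1]^{E(H)}: |F|-x(F)+x(\delta(W)\setminus F)\ge1\text{ for all }W\subseteq V(H),\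 F\subseteq\delta(W)\text{ with }|W\cap T|+|F|\text{ odd}\bigr\}.$$ (i) For every connected graph $G$ and every $T\subseteq V(G)$ with $|T|$ even, the integer vectors in $P(2G,T)\cap Q(2G,T)$ are exactly the incidence vectors (in $\mathbb R^{E(2G)}$) of the connected-$T$-joins of $G$. (ii) The unit integrality ratio of the family $\{P(2G,T)\cap Q(2G,T): G\text{ a connected graph with at least two vertices},\ T\subseteq V(G),\ |T|\text{ even}\}$ is exactly $\frac32$; that is, for every member $R\subseteq\mathbb R^{E(2G)}$ of this family the minima $\min\{\sum_e x_e: x\in R\cap\mathbb Z^{E(2G)}\}$ and $\min\{\sum_e x_e: x\in R\}$ exist, the latter is nonzero, and the supremum over all members of the ratio of the first to the second is $\frac32$. -/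

import Mathlib

open scoped Graph

universe u v w

noncomputable section

namespace Graph

variable {α : Type u} {β : Type v}

/-- The graph `2G`: every edge `e` is replaced by the two parallel edges `(e, false)` and
`(e, true)`. -/
def double (G : Graph α β) : Graph α (β × Bool) where
  vertexSet := V(G)
  IsLink p x y := G.IsLink p.1 x y
  edgeSet := {p | p.1 ∈ E(G)}
  isLink_symm _ _ := ⟨fun _ _ h => h.symm⟩
  eq_or_eq_of_isLink_of_isLink _ _ _ _ _ h h' := h.left_eq_or_eq h'
  edge_mem_iff_exists_isLink p := G.edge_mem_iff_exists_isLink p.1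
  left_mem_of_isLink _ _ _ h := h.left_mem

/-- A graph is connected if it has a vertex and any two of its vertices are joined by a walk. -/
def Connected (G : Graph α β) : Prop :=
  V(G).Nonempty ∧ ∀ x ∈ V(G), ∀ y ∈ V(G), Relation.ReflTransGen G.Adj x y

/-- `δ(W)`: the set of edges with exactly one endpoint in `W`. -/
def cut (G : Graph α β) (W : Set α) : Set β :=
  {e | ∃ x y, G.IsLink e x y ∧ x ∈ W ∧ y ∉ W}

/-- `δ(𝒲)`: the union of the cuts `δ(W)` over the classes `W` of a partition `𝒲` of `V(G)`. -/
def partitionCut (G : Graph α β) (𝒲 : Partition V(G)) : Set β :=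
  ⋃ W ∈ 𝒲, G.cut W

/-- `F` is a `T`-join in `G`: a set of edges of `G` such that `T` is exactly the set of vertices
incident with an odd number of edges of `F`. -/
def IsTJoin (G : Graph α β) (T : Set α) (F : Set β) : Prop :=
  F ⊆ E(G) ∧ T = {v ∈ V(G) | Odd (G.cut {v} ∩ F).ncard}

/-- `F` is a connected-`T`-join of `G`: a `T`-join in `2G` such that `(V(G), F)` is connected. -/
def IsConnectedTJoin (G : Graph α β) (T : Set α) (F : Set (β × Bool)) : Prop :=
  G.double.IsTJoin T F ∧ (G.double.restrict F).Connected

/-- `x(S)`: the sum of the entries of `x ∈ ℝ^{E(G)}` over the edges in `S`. -/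
def edgeSum (G : Graph α β) (x : E(G) → ℝ) (S : Set β) : ℝ :=
  ∑ᶠ e ∈ {e : E(G) | (e : β) ∈ S}, x e

/-- The incidence vector in `ℝ^{E(G)}` of a set `F` of edges. -/
def incidenceVector (G : Graph α β) (F : Set β) : E(G) → ℝ :=
  fun e => F.indicator 1 (e : β)

/-- The polyhedron `P(G, T)`. -/
def polyP (G : Graph α β) (T : Set α) : Set (E(G) → ℝ) :=
  {x | (∀ e, 0 ≤ x e) ∧
    (∀ W : Set α, W.Nonempty → W ⊂ V(G) → Even (W ∩ T).ncard → 2 ≤ G.edgeSum x (G.cut W)) ∧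
    (∀ 𝒲 : Partition V(G),
      ((𝒲 : Set (Set α)).ncard : ℝ) - 1 ≤ G.edgeSum x (G.partitionCut 𝒲))}

/-- The `T`-join polytope `Q(G, T)`. -/
def polyQ (G : Graph α β) (T : Set α) : Set (E(G) → ℝ) :=
  {x | (∀ e, 0 ≤ x e ∧ x e ≤ 1) ∧
    ∀ W : Set α, W ⊆ V(G) → ∀ F : Set β, F ⊆ G.cut W → Odd ((W ∩ T).ncard + F.ncard) →
      1 ≤ (F.ncard : ℝ) - G.edgeSum x F + G.edgeSum x (G.cut W \ F)}

theorem finite_edgeSet_double {G : Graph α β} (h : E(G).Finite) : E(G.double).Finite :=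
  (h.prod (Set.finite_univ (α := Bool))).subset fun _ hp => ⟨hp, trivial⟩

end Graph

/-- The integer vectors in `P ⊆ ℝ^ι`. -/
def integerPoints {ι : Type w} (P : Set (ι → ℝ)) : Set (ι → ℝ) :=
  {x ∈ P | ∀ i, ∃ k : ℤ, x i = k}

/-- `m` is the minimum of `∑ i, x i` over `x ∈ S` (attained). -/
def IsUnitMin {ι : Type w} [Finite ι] (S : Set (ι → ℝ)) (m : ℝ) : Prop :=
  IsLeast ((fun x => ∑ᶠ i, x i) '' S) m

/-- The family `(P i)` of polyhedra has unit integrality ratio `ρ`: for every member the minimum of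
`∑ x` over its integer points and the minimum `≠ 0` of `∑ x` over all its points exist, and `ρ` is
the supremum of the ratios of these two minima. -/
def IsUnitIntegralityRatio {I : Type u} {ι : I → Type v} [∀ i, Finite (ι i)]
    (P : ∀ i, Set (ι i → ℝ)) (ρ : ℝ) : Prop :=
  (∀ i, (∃ a, IsUnitMin (integerPoints (P i)) a) ∧ ∃ b, IsUnitMin (P i) b ∧ b ≠ 0) ∧
    IsLUB {r : ℝ | ∃ i a b, IsUnitMin (integerPoints (P i)) a ∧ IsUnitMin (P i) b ∧ r = a / b} ρ

/-- The index set of the family: pairs of a connected finite loopless multigraph `G` with at least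
two vertices and a set `T` of vertices of even cardinality. (For a one-vertex graph both minima are
`0`, and their ratio is undefined.) -/
structure ConnTInstance where
  α : Type u
  β : Type v
  G : Graph α β
  T : Set α
  loopless : G.Loopless
  finite_vertexSet : V(G).Finite
  finite_edgeSet : E(G).Finite
  connected : G.Connected
  nontrivial : V(G).Nontrivial
  subset : T ⊆ V(G)
  even : Even T.ncard

instance (I : ConnTInstance.{u, v}) : Finite E(I.G.double) :=
  (Graph.finite_edgeSet_double I.finite_edgeSet).to_subtype

end

/-! (i) For the incidence vector of `F`, the inequality of `Q` with `W = {v}` and `δ(v) ∩ F` as the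
chosen edge set fails if `v` has the wrong parity, and a partition into two classes detects
disconnectedness. Conversely, a `T`-join meets `δ(W)` with the parity of `|W ∩ T|`, and a connected
graph has at least `|𝒲| - 1` edges between the classes of `𝒲`.

(ii) Only the constraints of `P` are needed for the upper bound: every `x ∈ P(2G, T)` yields a
connected-`T`-join with at most `3/2 · x(E)` edges (`EdgeEnds.exists_spanning_join`). Cut vertices
are removed by induction. Without cut vertices, grow a set `S` from a vertex by ears with at least
two inner vertices; when this stops, the vertices outside `S` are independent
(`exists_earBuilt_independent`). On `S`, every even terminal set has a connected join with at most
`a` edges and a join with at most `b` edges, where `a + b ≤ 2|S| - 2` (`EarBuilt.extend`).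

Outside `S`, let `m₁` vertices be terminals and `m₀` not. Each terminal takes one edge to `S`, each
non-terminal two. The pairs of neighbours so joined are chosen such that a partition of `S`
certifies their number `q` of components (`Setoid.exists_pairs_card_add_crossing_le`); with the cut
and partition constraints this certificate gives `q + m₁ + 2m₀ ≤ 1 + x(E)`
(`card_quotient_add_le_sum`). Completing these edges by a connected join of `S`, or by at most `q -
1` connecting edges and a join of `S`, gives two solutions with at most `3x(E)` edges in total, so
one has at most `3/2 · x(E)`.

The bound is approached on the cycle of length `2k` with opposite terminals: the vector `1/2` has
value `2k`, whereas a connected join needs `3k - 2` edges. -/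

namespace Setoid

/-! ### Partitions of a finite set and uncrossing -/

variable {X : Type*}

/-- The rational functions which are constant on the classes of `r`. -/
def constFun (r : Setoid X) : Submodule ℚ (X → ℚ) where
  carrier := {h | ∀ x y, r x y → h x = h y}
  add_mem' ha hb x y hxy := by simp [ha x y hxy, hb x y hxy]
  zero_mem' _ _ _ := rfl
  smul_mem' c _ ha x y hxy := by simp [ha x y hxy]

theorem finrank_constFun [Finite X] (r : Setoid X) :
    Module.finrank ℚ r.constFun = Nat.card (Quotient r) := by
  classical
  have := Fintype.ofFinite X
  have := Fintype.ofFinite (Quotient r)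
  let e : r.constFun ≃ₗ[ℚ] (Quotient r → ℚ) :=
    { toFun := fun h q => Quotient.liftOn q h.1 h.2
      map_add' := fun a b => by ext q; induction q using Quotient.inductionOn; rfl
      map_smul' := fun a b => by ext q; induction q using Quotient.inductionOn; rfl
      invFun := fun h => ⟨fun x => h (Quotient.mk r x), fun _ _ hxy =>
        congrArg h (Quotient.sound (s := r) hxy)⟩
      left_inv := fun h => by ext x; rfl
      right_inv := fun h => by ext q; induction q using Quotient.inductionOn; rfl }
  rw [e.finrank_eq, Module.finrank_fintype_fun_eq_card, Nat.card_eq_fintype_card]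

/-- The number of classes is supermodular because it is the dimension of `constFun`: functions
constant for both relations are constant for `r ⊔ s`, sums of functions constant for one of them are
constant for `r ⊓ s`, and the dimension formula compares the two. -/
theorem card_quotient_add_le [Finite X] (r s : Setoid X) :
    Nat.card (Quotient r) + Nat.card (Quotient s) ≤
      Nat.card (Quotient (r ⊓ s)) + Nat.card (Quotient (r ⊔ s)) := by
  have hsup : r.constFun ⊓ s.constFun ≤ (r ⊔ s).constFun := by
    intro h hh x y hxy
    have : r ⊔ s ≤ Setoid.ker h := sup_le (fun x y hr => hh.1 x y hr) (fun x y hs => hh.2 x y hs)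
    exact this hxy
  have hinf : r.constFun ⊔ s.constFun ≤ (r ⊓ s).constFun :=
    sup_le (fun h hh x y hxy => hh x y hxy.1) (fun h hh x y hxy => hh x y hxy.2)
  have h1 := Submodule.finrank_mono hsup
  have h2 := Submodule.finrank_mono hinf
  have h3 := Submodule.finrank_sup_add_finrank_inf_eq r.constFun s.constFun
  simp only [finrank_constFun] at h1 h2 h3
  omega

/-- `A` is not contained in a single class of `r`. -/
def Crosses (r : Setoid X) (A : Finset X) : Prop := ¬ ∀ y ∈ A, ∀ z ∈ A, r y z

open scoped Classical in
/-- The number of members of a family of sets which meet more than one class of `r`. -/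
noncomputable def crossing {M : Type*} [Fintype M] (r : Setoid X) (N : M → Finset X) : ℕ :=
  ∑ v, if r.Crosses (N v) then 1 else 0

/-- Submodularity holds member by member: a set crossed by `r ⊓ s` is crossed by `r` or `s`, and a
set crossed by `r ⊔ s` is crossed by both. At `v` the right side counts two and the left side at
most one. -/
theorem crossing_inf_add_sup_le {M : Type*} [Fintype M] (r s : Setoid X) (N : M → Finset X)
    {v : M} (hr : r.Crosses (N v)) (hs : s.Crosses (N v)) (hv : ¬ (r ⊔ s).Crosses (N v)) :
    (r ⊓ s).crossing N + (r ⊔ s).crossing N + 1 ≤ r.crossing N + s.crossing N := by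
  classical
  have key : ∀ u, ((if (r ⊓ s).Crosses (N u) then 1 else 0) +
      (if (r ⊔ s).Crosses (N u) then 1 else 0) : ℕ) ≤
      (if r.Crosses (N u) then 1 else 0) + (if s.Crosses (N u) then 1 else 0) := by
    intro u
    have h1 : (r ⊓ s).Crosses (N u) → r.Crosses (N u) ∨ s.Crosses (N u) := by
      intro h
      by_contra! hc
      simp only [Crosses, not_not] at hc h
      exact h fun y hy z hz => ⟨hc.1 y hy z hz, hc.2 y hy z hz⟩
    have h2 : (r ⊔ s).Crosses (N u) → r.Crosses (N u) ∧ s.Crosses (N u) := by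
      intro h
      refine ⟨fun hc => h fun y hy z hz => ?_, fun hc => h fun y hy z hz => ?_⟩
      · exact (le_sup_left : r ≤ r ⊔ s) (hc y hy z hz)
      · exact (le_sup_right : s ≤ r ⊔ s) (hc y hy z hz)
    split_ifs <;> first | omega | tauto
  unfold crossing
  rw [← Finset.sum_add_distrib, ← Finset.sum_add_distrib, Nat.add_one_le_iff]
  refine Finset.sum_lt_sum (fun u _ => key u) ⟨v, Finset.mem_univ v, ?_⟩
  rw [if_pos hr, if_pos hs, if_neg hv]
  split_ifs <;> omega

theorem crossing_eq_crossing_update {M : Type*} [Fintype M] [DecidableEq M] (r : Setoid X)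
    (N : M → Finset X) (v : M) (A : Finset X) (h : r.Crosses (N v) ↔ r.Crosses A) :
    r.crossing (Function.update N v A) = r.crossing N := by
  classical
  unfold crossing
  refine Finset.sum_congr rfl fun u _ => if_congr ?_ rfl rfl
  rcases eq_or_ne u v with rfl | hu
  · rw [Function.update_self, h]
  · rw [Function.update_of_ne hu]

theorem crossing_le_crossing_update {M : Type*} [Fintype M] [DecidableEq M] (r : Setoid X)
    (N : M → Finset X) (v : M) (A : Finset X) :
    r.crossing N ≤ r.crossing (Function.update N v A) + 1 := by
  classical
  unfold crossing
  rw [← Finset.add_sum_erase _ _ (Finset.mem_univ v), ← Finset.add_sum_erase _ _ (Finset.mem_univ v)]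
  have : ∑ x ∈ Finset.univ.erase v, (if r.Crosses (N x) then 1 else 0) =
      ∑ x ∈ Finset.univ.erase v, (if r.Crosses (Function.update N v A x) then 1 else 0) := by
    refine Finset.sum_congr rfl fun u hu => ?_
    rw [Function.update_of_ne (Finset.ne_of_mem_erase hu)]
  rw [this]
  split_ifs <;> omega

/-- The equivalence relation generated by the pairs `(a v, b v)`. -/
abbrev ofPairs {M : Type*} (a b : M → X) : Setoid X :=
  Relation.EqvGen.setoid fun x y => ∃ v, a v = x ∧ b v = y

/-- Every family of nonempty sets can be shrunk to a family of pairs such that the number of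
components of these pairs is certified by a partition. -/
theorem exists_pairs_card_add_crossing_le [Finite X] {M : Type*} [Fintype M] (N : M → Finset X)
    (hN : ∀ v, (N v).Nonempty) :
    ∃ a b : M → X, (∀ v, a v ∈ N v ∧ b v ∈ N v) ∧
      ∃ r : Setoid X, Nat.card (Quotient (ofPairs a b)) + r.crossing N ≤ Nat.card (Quotient r) := by
  classical
  induction hn : ∑ v, (N v).card using Nat.strong_induction_on generalizing N with
  | _ n ih =>
  by_cases hbig : ∃ v, 3 ≤ (N v).card
  · obtain ⟨v, hv⟩ := hbig
    -- The certificate obtained after deleting `y` from `N v` is at most one too weak for the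
    -- original family, and only if the deletion destroys the crossing of `N v`.
    have step : ∀ y ∈ N v, ∃ a b : M → X, (∀ v, a v ∈ N v ∧ b v ∈ N v) ∧ ∃ r : Setoid X,
        Nat.card (Quotient (ofPairs a b)) + r.crossing N ≤ Nat.card (Quotient r) + 1 ∧
        (Nat.card (Quotient (ofPairs a b)) + r.crossing N ≤ Nat.card (Quotient r) ∨
          (r.Crosses (N v) ∧ ¬ r.Crosses ((N v).erase y))) := by
      intro y hy
      have hcard := Finset.card_erase_of_mem hy
      have hsum : ∑ u, (Function.update N v ((N v).erase y) u).card < n := by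
        rw [← hn]
        refine Finset.sum_lt_sum (fun u _ => ?_) ⟨v, Finset.mem_univ v, ?_⟩
        · rcases eq_or_ne u v with rfl | hu
          · simp only [Function.update_self]; omega
          · simp [hu]
        · simp only [Function.update_self]; omega
      obtain ⟨a, b, hab, r, hr⟩ := ih _ hsum (Function.update N v ((N v).erase y)) (fun u => by
        rcases eq_or_ne u v with rfl | hu
        · simp only [Function.update_self]
          exact Finset.card_pos.1 (by omega)
        · simpa [hu] using hN u) rfl
      refine ⟨a, b, fun u => ?_, r, ?_, ?_⟩
      · have := hab u
        rcases eq_or_ne u v with rfl | hu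
        · simp only [Function.update_self] at this
          exact ⟨Finset.mem_of_mem_erase this.1, Finset.mem_of_mem_erase this.2⟩
        · simpa [hu] using this
      · have := crossing_le_crossing_update r N v ((N v).erase y)
        omega
      · by_cases h : r.Crosses (N v) ∧ ¬ r.Crosses ((N v).erase y)
        · exact Or.inr h
        · left
          have h' : r.Crosses (N v) ↔ r.Crosses ((N v).erase y) := by
            refine ⟨fun h1 => by tauto, fun h1 h2 => h1 fun p hp q hq => ?_⟩
            exact h2 p (Finset.mem_of_mem_erase hp) q (Finset.mem_of_mem_erase hq)
          rwa [crossing_eq_crossing_update r N v _ h'] at hr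
    obtain ⟨y, z, w, hy, hz, hw, hyz, hyw, hzw⟩ :=
      (Finset.two_lt_card_iff.1 (show 2 < (N v).card by omega))
    obtain ⟨a, b, hab, r, hr, h | ⟨h1, h2⟩⟩ := step y hy
    · exact ⟨a, b, hab, r, h⟩
    obtain ⟨a', b', hab', r', hr', h | ⟨h1', h2'⟩⟩ := step z hz
    · exact ⟨a', b', hab', r', h⟩
    -- The third element `w` survives both deletions: `y` is equivalent to `w` under `r'`, all other
    -- elements under `r`.
    have hsup : ¬ (r ⊔ r').Crosses (N v) := by
      simp only [Crosses, not_not] at h2 h2' ⊢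
      have hle : r ≤ r ⊔ r' := le_sup_left
      have hle' : r' ≤ r ⊔ r' := le_sup_right
      have hpw : ∀ p ∈ N v, (r ⊔ r') p w := by
        intro p hp
        by_cases hpy : p = y
        · subst hpy
          exact hle' (h2' p (Finset.mem_erase.2 ⟨hyz, hp⟩) w (Finset.mem_erase.2 ⟨hzw.symm, hw⟩))
        · exact hle (h2 p (Finset.mem_erase.2 ⟨hpy, hp⟩) w (Finset.mem_erase.2 ⟨hyw.symm, hw⟩))
      exact fun p hp q hq => (r ⊔ r').trans (hpw p hp) ((r ⊔ r').symm (hpw q hq))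
    have hc := crossing_inf_add_sup_le r r' N h1 h1' hsup
    have hq := card_quotient_add_le r r'
    -- Both certificates miss by at most one, and uncrossing gains one. Hence `r ⊓ r'` certifies the
    -- pairs `(a, b)` or `r ⊔ r'` certifies the pairs `(a', b')`.
    by_contra hcon
    push Not at hcon
    have c1 := hcon a b hab (r ⊓ r')
    have c2 := hcon a b hab (r ⊔ r')
    have c3 := hcon a' b' hab' (r ⊓ r')
    have c4 := hcon a' b' hab' (r ⊔ r')
    omega
  · push Not at hbig
    have : ∀ v, ∃ a b, N v = {a, b} := by
      intro v
      have h1 := Finset.card_pos.2 (hN v)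
      have h2 := hbig v
      obtain h | h : (N v).card = 1 ∨ (N v).card = 2 := by omega
      · obtain ⟨a, ha⟩ := Finset.card_eq_one.1 h
        exact ⟨a, a, by simp [ha]⟩
      · obtain ⟨a, b, -, hab⟩ := Finset.card_eq_two.1 h
        exact ⟨a, b, hab⟩
    choose a b hab using this
    -- Once every set has at most two elements, the components of the pairs form a partition which
    -- no set crosses.
    refine ⟨a, b, fun v => by simp [hab], ofPairs a b, ?_⟩
    have : (ofPairs a b).crossing N = 0 := by
      unfold crossing
      refine Finset.sum_eq_zero fun v _ => if_neg ?_
      have hv : (ofPairs a b) (a v) (b v) := Relation.EqvGen.rel _ _ ⟨v, rfl, rfl⟩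
      simp only [Crosses, not_not, hab, Finset.mem_insert, Finset.mem_singleton]
      rintro y (rfl | rfl) z (rfl | rfl)
      exacts [Setoid.refl' _ _, hv, Setoid.symm' _ hv, Setoid.refl' _ _]
    omega

end Setoid

/-! ### Multigraphs given by the two ends of every edge -/

namespace EdgeEnds

variable {V ι : Type*} (s t : ι → V)

/-- The edge `e` has the ends `u` and `v`. -/
def Joins (e : ι) (u v : V) : Prop := (s e = u ∧ t e = v) ∨ (s e = v ∧ t e = u)

/-- Two vertices are linked by `L` if they are in the same component of the graph with edges `L`. -/
def linked (L : Multiset ι) : Setoid V :=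
  Relation.EqvGen.setoid fun u v => ∃ e ∈ L, Joins s t e u v

/-- All vertices in `S` are in the same component of the graph with edges `L`. -/
def Spans (S : Finset V) (L : Multiset ι) : Prop := ∀ u ∈ S, ∀ v ∈ S, linked s t L u v

variable {s t}

theorem Joins.symm {e : ι} {u v : V} (h : Joins s t e u v) : Joins s t e v u := Or.symm h

theorem linked_mono {L L' : Multiset ι} (h : L ⊆ L') : linked s t L ≤ linked s t L' := by
  exact Setoid.eqvGen_le fun u v ⟨e, he, hj⟩ => Relation.EqvGen.rel _ _ ⟨e, h he, hj⟩

theorem linked_of_mem {L : Multiset ι} {e : ι} (he : e ∈ L) {u v : V} (h : Joins s t e u v) :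
    linked s t L u v := Relation.EqvGen.rel _ _ ⟨e, he, h⟩

theorem linked_le {L : Multiset ι} {r : Setoid V} (h : ∀ e ∈ L, r (s e) (t e)) :
    linked s t L ≤ r := by
  refine Setoid.eqvGen_le fun u v ⟨e, he, hj⟩ => ?_
  rcases hj with ⟨rfl, rfl⟩ | ⟨rfl, rfl⟩
  · exact h e he
  · exact r.symm (h e he)

theorem Spans.mono {S : Finset V} {L L' : Multiset ι} (hL : Spans s t S L) (h : L ⊆ L') :
    Spans s t S L' := fun u hu v hv => linked_mono h (hL u hu v hv)

theorem spans_of_root {S : Finset V} {L : Multiset ι} (r : V)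
    (h : ∀ v ∈ S, linked s t L v r) : Spans s t S L :=
  fun u hu v hv => (linked s t L).trans (h u hu) ((linked s t L).symm (h v hv))

variable [DecidableEq V]

variable (s t) in
/-- The `ℤ/2`-boundary of a multiset of edges: the parity of the degree of every vertex. -/
def boundary : Multiset ι →+ (V → ZMod 2) :=
  Multiset.sumAddMonoidHom.comp
    (Multiset.mapAddMonoidHom fun e => (Pi.single (s e) 1 + Pi.single (t e) 1 : V → ZMod 2))

variable (s t) in
/-- `L` is a multiset of edges with both ends in `S`, and with odd degree where `T` is `1`. -/
structure IsJoin (S : Finset V) (T : V → ZMod 2) (L : Multiset ι) : Prop where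
  inside : ∀ e ∈ L, s e ∈ S ∧ t e ∈ S
  boundary_eq : boundary s t L = T

/-- `T` describes an even subset of `S`. -/
def EvenOn (S : Finset V) (T : V → ZMod 2) : Prop := (∀ v ∉ S, T v = 0) ∧ ∑ v ∈ S, T v = 0

theorem boundary_singleton {e : ι} {u v : V} (h : Joins s t e u v) :
    boundary s t {e} = Pi.single u 1 + Pi.single v 1 := by
  rcases h with ⟨rfl, rfl⟩ | ⟨rfl, rfl⟩
  · simp [boundary]
  · simp [boundary, add_comm]

theorem evenOn_boundary {S : Finset V} {L : Multiset ι} (h : ∀ e ∈ L, s e ∈ S ∧ t e ∈ S) :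
    EvenOn S (boundary s t L) := by
  induction L using Multiset.induction_on with
  | empty => simp [EvenOn]
  | cons e L ih =>
    obtain ⟨h1, h2⟩ := ih fun f hf => h f (Multiset.mem_cons_of_mem hf)
    obtain ⟨hs, ht⟩ := h e (Multiset.mem_cons_self e L)
    rw [← Multiset.singleton_add, map_add, boundary_singleton (Or.inl ⟨rfl, rfl⟩)]
    refine ⟨fun v hv => ?_, ?_⟩
    · have hsv : v ≠ s e := fun h => hv (h ▸ hs)
      have htv : v ≠ t e := fun h => hv (h ▸ ht)
      simp [h1 v hv, hsv, htv]
    · simp only [Pi.add_apply, Finset.sum_add_distrib, h2, add_zero]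
      rw [Finset.sum_pi_single', Finset.sum_pi_single', if_pos hs, if_pos ht]
      decide

theorem IsJoin.add {S S' : Finset V} {T T' : V → ZMod 2} {L L' : Multiset ι}
    (h : IsJoin s t S T L) (h' : IsJoin s t S' T' L') : IsJoin s t (S ∪ S') (T + T') (L + L') where
  inside e he := by
    rcases Multiset.mem_add.1 he with he | he
    · exact ⟨Finset.mem_union_left _ (h.inside e he).1, Finset.mem_union_left _ (h.inside e he).2⟩
    · exact ⟨Finset.mem_union_right _ (h'.inside e he).1,
        Finset.mem_union_right _ (h'.inside e he).2⟩
  boundary_eq := by rw [map_add, h.boundary_eq, h'.boundary_eq]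

theorem zmod_two_cases (x : ZMod 2) : x = 0 ∨ x = 1 := by
  revert x; decide

/-! ### Ears -/

/-- Prescribed degree parities at the inner vertices of an ear determine the parities of its edge
multiplicities up to one global flip `c`. The flip exchanges odd and even, so either can be made the
majority. -/
theorem exists_shift (δ : ℕ → ZMod 2) (l : ℕ) :
    ∃ c : ZMod 2, l ≤ 2 * ((Finset.range l).filter fun i => c + δ i = 1).card := by
  have h : ((Finset.range l).filter fun i => 0 + δ i = 1).card +
      ((Finset.range l).filter fun i => 1 + δ i = 1).card = l := by
    have : ((Finset.range l).filter fun i => 1 + δ i = 1) =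
        (Finset.range l).filter fun i => ¬ (0 + δ i = 1) := by
      refine Finset.filter_congr fun i _ => ?_
      rcases zmod_two_cases (δ i) with h | h <;> rw [h] <;> decide
    rw [this, Finset.card_filter_add_card_filter_not, Finset.card_range]
  by_cases h0 : l ≤ 2 * ((Finset.range l).filter fun i => 0 + δ i = 1).card
  · exact ⟨0, h0⟩
  · exact ⟨1, by omega⟩

theorem exists_multiplicity_small (δ : ℕ → ZMod 2) (l : ℕ) :
    ∃ (c : ZMod 2) (m : ℕ → ℕ), (∀ i, (m i : ZMod 2) = c + δ i) ∧
      ∑ i ∈ Finset.range l, m i ≤ l / 2 := by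
  obtain ⟨c, hc⟩ := exists_shift δ l
  -- The shift is `c + 1` because the majority class found for `c` should receive no edge.
  refine ⟨c + 1, fun i => if c + δ i = 1 then 0 else 1, fun i => ?_, ?_⟩
  · have : ∀ x y : ZMod 2, ((if x + y = 1 then 0 else 1 : ℕ) : ZMod 2) = x + 1 + y := by decide
    exact this c (δ i)
  · have h := Finset.card_filter_add_card_filter_not (s := Finset.range l) (fun i => c + δ i = 1)
    rw [Finset.card_range] at h
    have h' : ∑ i ∈ Finset.range l, (if c + δ i = 1 then 0 else 1) =
        ((Finset.range l).filter fun i => ¬ (c + δ i = 1)).card := by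
      rw [Finset.card_filter]
      exact Finset.sum_congr rfl fun i _ => by split_ifs <;> rfl
    beta_reduce
    omega

/-- Edges of odd parity are taken once and edges of even parity twice, except that one even edge `z`
is dropped: an ear attached at both ends stays connected without it. If there is no even edge, the
cost is `l`, which is at most `3 * (l - 1) / 2` only from `l = 3` on. This is why ears need at least
two inner vertices. -/
theorem exists_multiplicity_connected (δ : ℕ → ZMod 2) {l : ℕ} (hl : 3 ≤ l) :
    ∃ (c : ZMod 2) (m : ℕ → ℕ), (∀ i, (m i : ZMod 2) = c + δ i ∨ l ≤ i) ∧
      (∃ z, ∀ i < l, i ≠ z → 0 < m i) ∧ ∑ i ∈ Finset.range l, m i ≤ 3 * (l - 1) / 2 := by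
  obtain ⟨c, hc⟩ := exists_shift δ l
  by_cases hall : ∀ i < l, c + δ i = 1
  · refine ⟨c, fun _ => 1, fun i => ?_, ⟨0, fun _ _ _ => one_pos⟩, ?_⟩
    · by_cases hi : i < l
      · left; rw [hall i hi, Nat.cast_one]
      · right; omega
    · simp; omega
  · push Not at hall
    obtain ⟨z, hzl, hz⟩ := hall
    refine ⟨c, fun i => if c + δ i = 1 then 1 else if i = z then 0 else 2, fun i => Or.inl ?_,
      ⟨z, fun i _ hi => ?_⟩, ?_⟩
    · beta_reduce
      rcases zmod_two_cases (c + δ i) with h | h <;> rw [h]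
      · rw [if_neg zero_ne_one]; split_ifs <;> decide
      · rw [if_pos rfl, Nat.cast_one]
    · simp only [hi, if_false]; split_ifs <;> norm_num
    · have h := Finset.card_filter_add_card_filter_not (s := Finset.range l) (fun i => c + δ i = 1)
      rw [Finset.card_range] at h
      -- Restoring the two dropped copies of `z` gives the number of odd edges plus twice the number
      -- of even ones.
      have h1 : ∑ i ∈ Finset.range l, ((if c + δ i = 1 then 1 else if i = z then 0 else 2) +
          if i = z then 2 else 0) = ∑ i ∈ Finset.range l, ((if c + δ i = 1 then 1 else 0) +
          2 * if ¬ (c + δ i = 1) then 1 else 0) := by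
        refine Finset.sum_congr rfl fun i _ => ?_
        by_cases hi : i = z
        · subst hi; simp [hz]
        · by_cases h : c + δ i = 1 <;> simp [hi, h]
      rw [Finset.sum_add_distrib, Finset.sum_add_distrib, ← Finset.mul_sum, ← Finset.card_filter,
        ← Finset.card_filter, Finset.sum_ite_eq' , if_pos (Finset.mem_range.2 hzl)] at h1
      beta_reduce
      omega

/-- The multiset in which the edge `e i` occurs `m i` times, for `i < l`. -/
def ear (e : ℕ → ι) (m : ℕ → ℕ) (l : ℕ) : Multiset ι :=
  ∑ i ∈ Finset.range l, m i • ({e i} : Multiset ι)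

theorem card_ear (e : ℕ → ι) (m : ℕ → ℕ) (l : ℕ) :
    (ear e m l).card = ∑ i ∈ Finset.range l, m i := by
  simp [ear]

theorem mem_ear {e : ℕ → ι} {m : ℕ → ℕ} {l : ℕ} {f : ι} :
    f ∈ ear e m l ↔ ∃ i < l, 0 < m i ∧ f = e i := by
  simp only [ear, Multiset.mem_sum, Finset.mem_range]
  refine exists_congr fun i => and_congr_right fun _ => ?_
  rw [Multiset.mem_nsmul, Multiset.mem_singleton, Nat.pos_iff_ne_zero]

/-- The two edges at the inner vertex `q (i + 1)` contribute `m i + m (i + 1)`, which is `T (q (i +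
1))` modulo 2. -/
theorem boundary_ear {e : ℕ → ι} {q : ℕ → V} {m : ℕ → ℕ} {l : ℕ}
    (he : ∀ i < l + 1, Joins s t (e i) (q i) (q (i + 1))) (T : V → ZMod 2)
    (hm : ∀ i < l, (m (i + 1) : ZMod 2) = m i + T (q (i + 1))) :
    boundary s t (ear e m (l + 1)) = Pi.single (q 0) (m 0 : ZMod 2) +
      Pi.single (q (l + 1)) (m l : ZMod 2) +
      ∑ i ∈ Finset.range l, Pi.single (q (i + 1)) (T (q (i + 1))) := by
  have hsm : ∀ (n : ℕ) (v : V), n • (Pi.single v 1 : V → ZMod 2) = Pi.single v (n : ZMod 2) := by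
    intro n v
    rw [← Pi.single_smul', nsmul_one]
  induction l with
  | zero =>
    simp only [ear, zero_add, Finset.range_one, Finset.sum_singleton, map_nsmul,
      boundary_singleton (he 0 (by omega)), nsmul_add, hsm, Finset.range_zero, Finset.sum_empty,
      add_zero]
  | succ l ih =>
    have ih := ih (fun i hi => he i (by omega)) (fun i hi => hm i (by omega))
    rw [ear, Finset.sum_range_succ, map_add, ← ear, ih, map_nsmul,
      boundary_singleton (he (l + 1) (by omega)), nsmul_add, hsm, hsm,
      Finset.sum_range_succ, hm l (by omega), Pi.single_add]
    have h2 : (Pi.single (q (l + 1)) (m l : ZMod 2) : V → ZMod 2) +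
        Pi.single (q (l + 1)) (m l : ZMod 2) = 0 := by
      rw [← Pi.single_add, CharTwo.add_self_eq_zero, Pi.single_zero]
    linear_combination h2

omit [DecidableEq V] in
theorem linked_ear {e : ℕ → ι} {q : ℕ → V} {m : ℕ → ℕ} {l : ℕ}
    (he : ∀ i < l, Joins s t (e i) (q i) (q (i + 1))) {a b : ℕ} (hab : a ≤ b) (hb : b ≤ l)
    (hm : ∀ j, a ≤ j → j < b → 0 < m j) : linked s t (ear e m l) (q a) (q b) := by
  induction b, hab using Nat.le_induction with
  | base => exact Setoid.refl' _ _
  | succ b hab ih =>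
    refine Setoid.trans' _ (ih (by omega) fun j h1 h2 => hm j h1 (by omega)) ?_
    exact linked_of_mem (mem_ear.2 ⟨b, by omega, hm b hab (by omega), rfl⟩) (he b (by omega))

variable (s t) in
/-- For every even subset of `S` there are a short join and a short connected join. -/
def EarBuilt (S : Finset V) : Prop :=
  ∃ a b : ℕ, a + b + 2 ≤ 2 * S.card ∧ ∀ T, EvenOn S T →
    (∃ L, IsJoin s t S T L ∧ Spans s t S L ∧ L.card ≤ a) ∧ ∃ L, IsJoin s t S T L ∧ L.card ≤ b

theorem earBuilt_singleton (r : V) : EarBuilt s t {r} := by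
  refine ⟨0, 0, by simp, fun T hT => ?_⟩
  have hT0 : T = 0 := by
    ext v
    by_cases hv : v = r
    · subst hv; simpa using hT.2
    · exact hT.1 v (by simpa using hv)
  subst hT0
  refine ⟨⟨0, ⟨by simp, by simp⟩, ?_, by simp⟩, 0, ⟨by simp, by simp⟩, by simp⟩
  intro u hu v hv
  rw [Finset.mem_singleton.1 hu, Finset.mem_singleton.1 hv]

/-- An ear with `l` inner vertices costs `⌊3l/2⌋` edges in the connected join and `⌊(l+1)/2⌋` in the
other one, together exactly `2l`; so `a + b + 2 ≤ 2 * S.card` is preserved. Choosing the ear first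
leaves on `S` the problem for `T` corrected by its boundary. The two ends of the ear may coincide,
as they must for the first one. -/
theorem EarBuilt.extend {S : Finset V} (hS : EarBuilt s t S) {l : ℕ} (hl : 2 ≤ l) {q : ℕ → V}
    {e : ℕ → ι} (he : ∀ i < l + 1, Joins s t (e i) (q i) (q (i + 1))) (h0 : q 0 ∈ S)
    (hend : q (l + 1) ∈ S) (hout : ∀ i < l, q (i + 1) ∉ S)
    (hinj : ∀ i < l, ∀ j < l, q (i + 1) = q (j + 1) → i = j) :
    EarBuilt s t (S ∪ (Finset.range l).image fun i => q (i + 1)) := by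
  set I := (Finset.range l).image fun i => q (i + 1) with hI
  have hdisj : Disjoint S I := by
    rw [Finset.disjoint_right]
    intro v hv
    obtain ⟨i, hi, rfl⟩ := Finset.mem_image.1 hv
    exact hout i (Finset.mem_range.1 hi)
  have hcard : (S ∪ I).card = S.card + l := by
    rw [Finset.card_union_of_disjoint hdisj, hI, Finset.card_image_of_injOn, Finset.card_range]
    intro i hi j hj hij
    exact hinj i (by simpa using hi) j (by simpa using hj) hij
  have hq : ∀ i ≤ l + 1, q i ∈ S ∪ I := by
    intro i hi
    obtain rfl | rfl | ⟨h1, h2⟩ : i = 0 ∨ i = l + 1 ∨ (0 < i ∧ i < l + 1) := by omega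
    · exact Finset.mem_union_left _ h0
    · exact Finset.mem_union_left _ hend
    · refine Finset.mem_union_right _ (Finset.mem_image.2 ⟨i - 1, Finset.mem_range.2 (by omega), ?_⟩)
      simp only [Nat.sub_add_cancel h1]
  have hinside : ∀ m, ∀ f ∈ ear e m (l + 1), s f ∈ S ∪ I ∧ t f ∈ S ∪ I := by
    intro m f hf
    obtain ⟨i, hi, -, rfl⟩ := mem_ear.1 hf
    rcases he i hi with ⟨h1, h2⟩ | ⟨h1, h2⟩ <;> rw [h1, h2]
    · exact ⟨hq _ (by omega), hq _ (by omega)⟩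
    · exact ⟨hq _ (by omega), hq _ (by omega)⟩
  obtain ⟨a, b, hab, hjoin⟩ := hS
  have key : ∀ T, EvenOn (S ∪ I) T → ∀ m : ℕ → ℕ,
      (∀ i < l, (m (i + 1) : ZMod 2) = m i + T (q (i + 1))) →
      EvenOn S (T + boundary s t (ear e m (l + 1))) := by
    intro T hT m hm
    have hE := evenOn_boundary (hinside m)
    have hzero : ∀ v ∉ S, (T + boundary s t (ear e m (l + 1))) v = 0 := by
      intro v hv
      by_cases hvI : v ∈ I
      · obtain ⟨i, hi, rfl⟩ := Finset.mem_image.1 hvI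
        rw [Finset.mem_range] at hi
        rw [boundary_ear he T hm]
        simp only [Pi.add_apply, Finset.sum_apply]
        rw [Pi.single_eq_of_ne (fun h => hv (by rw [h]; exact h0)), Pi.single_eq_of_ne (fun h => hv (by rw [h]; exact hend)),
          Finset.sum_eq_single_of_mem i (Finset.mem_range.2 hi), Pi.single_eq_same, zero_add,
          zero_add, CharTwo.add_self_eq_zero]
        intro j hj hji
        refine Pi.single_eq_of_ne (fun h => hji ?_) _
        exact (hinj i hi j (Finset.mem_range.1 hj) h).symm
      · have hv' : v ∉ S ∪ I := by simp [hv, hvI]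
        simp [hT.1 v hv', hE.1 v hv']
    refine ⟨hzero, ?_⟩
    have h1 : ∑ v ∈ S ∪ I, (T + boundary s t (ear e m (l + 1))) v = 0 := by
      simp only [Pi.add_apply, Finset.sum_add_distrib, hT.2, hE.2, add_zero]
    rw [Finset.sum_union hdisj] at h1
    rwa [Finset.sum_eq_zero (s := I) fun v hv => hzero v (Finset.disjoint_right.1 hdisj hv),
      add_zero] at h1
  have hback : ∀ (T : V → ZMod 2) m L, IsJoin s t S (T + boundary s t (ear e m (l + 1))) L →
      IsJoin s t (S ∪ I) T (L + ear e m (l + 1)) := by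
    intro T m L hL
    have h := hL.add (S' := S ∪ I) ⟨hinside m, rfl⟩
    rw [add_assoc, ← Finset.union_assoc, Finset.union_self] at h
    convert h using 1
    ext v
    simp [CharTwo.add_self_eq_zero]
  refine ⟨a + 3 * l / 2, b + (l + 1) / 2, by omega, fun T hT => ?_⟩
  -- With these partial sums the parity condition at the inner vertices reads `m i = m 0 + δ i`
  -- modulo 2.
  let δ : ℕ → ZMod 2 := fun i => ∑ j ∈ Finset.range i, T (q (j + 1))
  have hδ : ∀ i, δ (i + 1) = δ i + T (q (i + 1)) := fun i => Finset.sum_range_succ _ _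
  constructor
  · obtain ⟨c, m, hm, ⟨z, hz⟩, hsum⟩ := exists_multiplicity_connected δ (show 3 ≤ l + 1 by omega)
    have hm' : ∀ i < l, (m (i + 1) : ZMod 2) = m i + T (q (i + 1)) := by
      intro i hi
      rw [(hm (i + 1)).resolve_right (by omega), (hm i).resolve_right (by omega), hδ, add_assoc]
    obtain ⟨L, hL, hsp, hLc⟩ := (hjoin _ (key T hT m hm')).1
    refine ⟨_, hback T m L hL, ?_, ?_⟩
    · have hspan := hsp.mono (Multiset.subset_of_le (Multiset.le_add_right L (ear e m (l + 1))))
      have hear : linked s t (ear e m (l + 1)) ≤ linked s t (L + ear e m (l + 1)) :=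
        linked_mono (Multiset.subset_of_le (Multiset.le_add_left _ _))
      refine spans_of_root (q 0) fun v hv => ?_
      rcases Finset.mem_union.1 hv with hv | hv
      · exact hspan v hv _ h0
      · obtain ⟨i, hi, rfl⟩ := Finset.mem_image.1 hv
        rw [Finset.mem_range] at hi
        -- Only the edge `z` may be missing, so the vertices before it reach `q 0` along the ear and
        -- those after it reach `q (l + 1)`.
        by_cases hiz : i + 1 ≤ z
        · refine Setoid.symm' _ (hear (linked_ear he (Nat.zero_le _) (by omega) fun j _ hj => ?_))
          exact hz j (by omega) (by omega)
        · refine Setoid.trans' _ (hear (linked_ear he (show i + 1 ≤ l + 1 by omega) le_rfl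
            fun j hj1 hj2 => ?_)) (hspan _ hend _ h0)
          exact hz j (by omega) (by omega)
    · rw [Multiset.card_add, card_ear]
      have : 3 * (l + 1 - 1) / 2 = 3 * l / 2 := by simp
      omega
  · obtain ⟨c, m, hm, hsum⟩ := exists_multiplicity_small δ (l + 1)
    have hm' : ∀ i < l, (m (i + 1) : ZMod 2) = m i + T (q (i + 1)) := by
      intro i hi
      rw [hm, hm, hδ, add_assoc]
    obtain ⟨L, hL, hLc⟩ := (hjoin _ (key T hT m hm')).2
    refine ⟨_, hback T m L hL, ?_⟩
    rw [Multiset.card_add, card_ear]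
    omega

end EdgeEnds

/-! ### Connecting edges and a maximal set built from long ears -/

namespace Setoid

variable {X : Type*}

theorem card_quotient_le_of_le [Finite X] {r r' : Setoid X} (h : r ≤ r') :
    Nat.card (Quotient r') ≤ Nat.card (Quotient r) :=
  Nat.card_le_card_of_surjective (Quotient.map' id h) fun q => by
    induction q using Quotient.inductionOn with
    | _ x => exact ⟨Quotient.mk r x, rfl⟩

theorem card_quotient_lt_of_lt [Finite X] {r r' : Setoid X} (h : r < r') :
    Nat.card (Quotient r') < Nat.card (Quotient r) := by
  classical
  have := Fintype.ofFinite (Quotient r)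
  have := Fintype.ofFinite (Quotient r')
  rw [Nat.card_eq_fintype_card, Nat.card_eq_fintype_card]
  refine Fintype.card_lt_of_surjective_not_injective (Quotient.map' id h.le) (fun q => ?_)
    fun hinj => h.not_ge fun x y hxy => ?_
  · induction q using Quotient.inductionOn with
    | _ x => exact ⟨Quotient.mk r x, rfl⟩
  · exact Quotient.exact (@hinj (Quotient.mk r x) (Quotient.mk r y) (Quotient.sound (s := r') hxy))

end Setoid

namespace EdgeEnds

variable {V ι : Type*} {s t : ι → V}

/-- Greedy choice: an edge of `L₀` between two classes of `r` merges them and lowers the number of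
classes on `S`. If there is no such edge, `S` lies in one class because `L₀` spans it. -/
theorem exists_connectors {S : Finset V} (hS : S.Nonempty) {L₀ : Multiset ι}
    (hin : ∀ e ∈ L₀, s e ∈ S ∧ t e ∈ S) (hspan : Spans s t S L₀) (r : Setoid V) :
    ∃ K : Multiset ι, (∀ e ∈ K, s e ∈ S ∧ t e ∈ S) ∧
      K.card + 1 ≤ Nat.card (Quotient (r.comap (Subtype.val : S → V))) ∧
      ∀ u ∈ S, ∀ v ∈ S, (r ⊔ linked s t K) u v := by
  induction hn : Nat.card (Quotient (r.comap (Subtype.val : S → V)))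
    using Nat.strong_induction_on generalizing r with
  | _ n ih =>
  by_cases hall : ∀ e ∈ L₀, r (s e) (t e)
  · refine ⟨0, by simp, ?_, fun u hu v hv => ?_⟩
    · have : Nonempty (Quotient (r.comap (Subtype.val : S → V))) :=
        ⟨Quotient.mk _ ⟨hS.choose, hS.choose_spec⟩⟩
      rw [← hn, Multiset.card_zero, zero_add]
      exact Nat.card_pos
    · exact (le_sup_left : r ≤ _) (linked_le hall (hspan u hu v hv))
  · push Not at hall
    obtain ⟨e, he, hr⟩ := hall
    have hle : r ≤ r ⊔ linked s t {e} := le_sup_left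
    have hlt : r.comap (Subtype.val : S → V) < (r ⊔ linked s t {e}).comap (Subtype.val : S → V) := by
      refine lt_of_le_not_ge (fun x y hxy => hle hxy) fun hge => hr ?_
      have : ((r ⊔ linked s t {e}).comap (Subtype.val : S → V))
          ⟨s e, (hin e he).1⟩ ⟨t e, (hin e he).2⟩ :=
        (le_sup_right : linked s t {e} ≤ _)
          (linked_of_mem (Multiset.mem_singleton_self e) (Or.inl ⟨rfl, rfl⟩))
      exact hge this
    obtain ⟨K, hK, hcard, hlink⟩ := ih _ (hn ▸ Setoid.card_quotient_lt_of_lt hlt) _ rfl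
    refine ⟨e ::ₘ K, fun f hf => ?_, ?_, fun u hu v hv => ?_⟩
    · rcases Multiset.mem_cons.1 hf with rfl | hf
      · exact hin _ he
      · exact hK f hf
    · have := Setoid.card_quotient_lt_of_lt hlt
      rw [Multiset.card_cons]
      omega
    · have h1 : linked s t {e} ≤ linked s t (e ::ₘ K) := linked_mono (by simp)
      have h2 : linked s t K ≤ linked s t (e ::ₘ K) := linked_mono (Multiset.subset_cons K e)
      have : r ⊔ linked s t {e} ⊔ linked s t K ≤ r ⊔ linked s t (e ::ₘ K) :=
        sup_le (sup_le le_sup_left (h1.trans le_sup_right)) (h2.trans le_sup_right)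
      exact this (hlink u hu v hv)

variable [DecidableEq V]

variable (s t) in
/-- Any two complementary nonempty parts of `A` are joined by an edge. -/
def Conn (A : Finset V) : Prop :=
  ∀ B ⊆ A, B.Nonempty → B ≠ A → ∃ e, ∃ u ∈ B, ∃ v ∈ A \ B, Joins s t e u v

/-- Take `S` of maximal size. Two adjacent vertices outside `S` lie in a component `C` of the rest,
and every edge of `U` leaving `C` ends in `S`. Connectivity of `U` gives such an edge at some `c ∈
C`, and connectivity of `U` without `c` gives another at some `c' ≠ c` in `C`. A path in `C` from
`c` to `c'` completes an ear with at least two inner vertices, contradicting maximality. -/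
theorem exists_earBuilt_independent {U : Finset V} (hU : U.Nonempty) (hconn : Conn s t U)
    (hcut : ∀ c ∈ U, Conn s t (U.erase c)) :
    ∃ S ⊆ U, S.Nonempty ∧ EarBuilt s t S ∧
      ∀ e, ∀ u ∈ U \ S, ∀ v ∈ U \ S, Joins s t e u v → u = v := by
  classical
  obtain ⟨r, hr⟩ := hU
  obtain ⟨S, hS, hmax⟩ := Finset.exists_max_image
    (U.powerset.filter fun S => S.Nonempty ∧ EarBuilt s t S) Finset.card
    ⟨{r}, by simp [hr, earBuilt_singleton]⟩
  simp only [Finset.mem_filter, Finset.mem_powerset] at hS hmax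
  obtain ⟨hSU, hSne, hSe⟩ := hS
  refine ⟨S, hSU, hSne, hSe, fun e₀ x hx y hy hxy => ?_⟩
  by_contra hne
  let H : SimpleGraph V :=
    { Adj := fun u v => u ≠ v ∧ u ∈ U \ S ∧ v ∈ U \ S ∧ ∃ e, Joins s t e u v
      symm := ⟨fun u v ⟨h1, h2, h3, e, he⟩ => ⟨h1.symm, h3, h2, e, he.symm⟩⟩
      loopless := ⟨fun u h => h.1 rfl⟩ }
  have hreach : ∀ {u v}, H.Reachable u v → u ∈ U \ S → v ∈ U \ S := by
    rintro u v ⟨p⟩ hu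
    induction p with
    | nil => exact hu
    | cons h _ ih => exact ih h.2.2.1
  let C := U.filter (H.Reachable x)
  have hxC : x ∈ C := Finset.mem_filter.2 ⟨(Finset.mem_sdiff.1 hx).1, SimpleGraph.Reachable.refl x⟩
  have hyC : y ∈ C := Finset.mem_filter.2 ⟨(Finset.mem_sdiff.1 hy).1,
    SimpleGraph.Adj.reachable (⟨hne, hx, hy, e₀, hxy⟩ : H.Adj x y)⟩
  have hCD : ∀ v ∈ C, v ∈ U \ S := fun v hv => hreach (Finset.mem_filter.1 hv).2 hx
  have hleave : ∀ e, ∀ u ∈ C, ∀ v ∈ U, v ∉ C → Joins s t e u v → v ∈ S := by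
    intro e u hu v hv hvC hj
    by_contra hvS
    have hvD : v ∈ U \ S := Finset.mem_sdiff.2 ⟨hv, hvS⟩
    have hadj : H.Adj u v := ⟨fun h => hvC (h ▸ hu), hCD u hu, hvD, e, hj⟩
    exact hvC (Finset.mem_filter.2 ⟨hv, (Finset.mem_filter.1 hu).2.trans hadj.reachable⟩)
  obtain ⟨z, hz⟩ := hSne
  have hzC : z ∉ C := fun h => (Finset.mem_sdiff.1 (hCD z h)).2 hz
  obtain ⟨e, c, hc, v, hv, hj⟩ := hconn C (Finset.filter_subset _ _) ⟨x, hxC⟩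
    (fun h => hzC (h ▸ hSU hz))
  rw [Finset.mem_sdiff] at hv
  have hvS := hleave e c hc v hv.1 hv.2 hj
  have hcD := Finset.mem_sdiff.1 (hCD c hc)
  obtain ⟨e', c', hc', v', hv', hj'⟩ := hcut c hcD.1 (C.erase c)
    (Finset.erase_subset_erase _ (Finset.filter_subset _ _))
    (by
      by_cases hcx : c = x
      · exact ⟨y, Finset.mem_erase.2 ⟨fun h => hne (hcx ▸ h.symm), hyC⟩⟩
      · exact ⟨x, Finset.mem_erase.2 ⟨fun h => hcx h.symm, hxC⟩⟩)
    (fun h => by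
      have : z ∈ C.erase c := h ▸ Finset.mem_erase.2 ⟨fun h => hzC (h ▸ hc), hSU hz⟩
      exact hzC (Finset.mem_of_mem_erase this))
  rw [Finset.mem_erase] at hc'
  rw [Finset.mem_sdiff, Finset.mem_erase] at hv'
  have hvS' := hleave e' c' hc'.2 v' hv'.1.2
    (fun h => hv'.2 (Finset.mem_erase.2 ⟨hv'.1.1, h⟩)) hj'
  obtain ⟨p, hp⟩ := ((Finset.mem_filter.1 hc).2.symm.trans
    (Finset.mem_filter.1 hc'.2).2).exists_isPath
  have hlen : 0 < p.length := by
    rw [Nat.pos_iff_ne_zero]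
    exact fun h => hc'.1 (SimpleGraph.Walk.eq_of_length_eq_zero h).symm
  have hpD : ∀ i, p.getVert i ∈ U \ S := fun i => hreach (p.take i).reachable (hCD c hc)
  -- The inner vertices of the ear are the `p.length + 1` vertices of the path, shifted by one to
  -- make room for the end `v` at index 0.
  let q : ℕ → V := fun i =>
    if i = 0 then v else if i ≤ p.length + 1 then p.getVert (i - 1) else v'
  have hq0 : q 0 = v := rfl
  have hq : ∀ i < p.length + 1, q (i + 1) = p.getVert i := by
    intro i hi
    simp only [q, Nat.succ_ne_zero, if_false, Nat.add_sub_cancel]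
    exact if_pos (by omega)
  have hql : q (p.length + 1 + 1) = v' := by
    simp [q]
  have hedge : ∀ i, ∃ e, i < p.length + 1 + 1 → Joins s t e (q i) (q (i + 1)) := by
    intro i
    by_cases hi : i < p.length + 1 + 1
    · obtain rfl | rfl | ⟨h1, h2⟩ : i = 0 ∨ i = p.length + 1 ∨ (0 < i ∧ i < p.length + 1) := by
        omega
      · refine ⟨e, fun _ => ?_⟩
        rw [hq0, hq 0 (by omega), SimpleGraph.Walk.getVert_zero]
        exact hj.symm
      · refine ⟨e', fun _ => ?_⟩
        rw [hql, hq _ (by omega), SimpleGraph.Walk.getVert_length]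
        exact hj'
      · obtain ⟨j, rfl⟩ : ∃ j, i = j + 1 := ⟨i - 1, by omega⟩
        have := p.adj_getVert_succ (i := j) (by omega)
        rw [hq j (by omega), hq (j + 1) h2]
        exact ⟨this.2.2.2.choose, fun _ => this.2.2.2.choose_spec⟩
    · exact ⟨e, fun h => absurd h hi⟩
  choose f hf using hedge
  have hext := hSe.extend (l := p.length + 1) (by omega) hf (by rw [hq0]; exact hvS)
    (by rw [hql]; exact hvS') (fun i hi => by
      rw [hq i hi]; exact (Finset.mem_sdiff.1 (hpD i)).2)
    (fun i hi j hj hij => by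
      rw [hq i hi, hq j hj] at hij
      exact hp.getVert_injOn (show i ≤ _ by omega) (show j ≤ _ by omega) hij)
  have hle := hmax _ ⟨Finset.union_subset hSU fun w hw => ?_,
    ⟨z, Finset.mem_union_left _ hz⟩, hext⟩
  · have hlt : S.card < (S ∪ (Finset.range (p.length + 1)).image fun i => q (i + 1)).card := by
      refine Finset.card_lt_card (Finset.ssubset_iff_subset_ne.2 ⟨Finset.subset_union_left,
        fun h => hcD.2 ?_⟩)
      rw [h]
      refine Finset.mem_union_right _ (Finset.mem_image.2 ⟨0, by simp, ?_⟩)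
      rw [hq 0 (by omega), SimpleGraph.Walk.getVert_zero]
    omega
  · obtain ⟨i, hi, rfl⟩ := Finset.mem_image.1 hw
    rw [hq i (Finset.mem_range.1 hi)]
    exact (Finset.mem_sdiff.1 (hpD i)).1

end EdgeEnds

/-! ### The lower bound on `x(E)` from a partition of `S` -/

namespace EdgeEnds

variable {V ι : Type*} {s t : ι → V} [DecidableEq V] [Fintype ι]

variable (s t) in
/-- The edges with both ends in `U`. -/
def edgesIn (U : Finset V) : Finset ι := Finset.univ.filter fun e => s e ∈ U ∧ t e ∈ U

theorem mem_edgesIn {U : Finset V} {e : ι} : e ∈ edgesIn s t U ↔ s e ∈ U ∧ t e ∈ U := by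
  simp [edgesIn]

variable (s t) in
/-- The constraints on the cuts that contain an even number of terminals. -/
def CutBound (U : Finset V) (T : V → ZMod 2) (x : ι → ℝ) : Prop :=
  ∀ W ⊆ U, W.Nonempty → W ≠ U → ∑ v ∈ W, T v = 0 →
    2 ≤ ∑ e ∈ (edgesIn s t U).filter fun e => ¬ (s e ∈ W ↔ t e ∈ W), x e

variable (s t) in
/-- The partition constraints; partitions are given by colourings of the vertices. -/
def PartitionBound (U : Finset V) (x : ι → ℝ) : Prop :=
  ∀ f : V → V, ((U.image f).card : ℝ) ≤
    1 + ∑ e ∈ (edgesIn s t U).filter fun e => f (s e) ≠ f (t e), x e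

omit [DecidableEq V] [Fintype ι] in
theorem Joins.ends_mem {U : Finset V} {e : ι} {u v : V} (h : Joins s t e u v) (hu : u ∈ U)
    (hv : v ∈ U) : s e ∈ U ∧ t e ∈ U := by
  rcases h with ⟨rfl, rfl⟩ | ⟨rfl, rfl⟩
  exacts [⟨hu, hv⟩, ⟨hv, hu⟩]

theorem PartitionBound.conn {U : Finset V} {x : ι → ℝ} (h : PartitionBound s t U x) :
    Conn s t U := by
  intro B hB hne hBU
  obtain ⟨b, hb⟩ := hne
  obtain ⟨c, hc⟩ := Finset.exists_of_ssubset (Finset.ssubset_iff_subset_ne.2 ⟨hB, hBU⟩)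
  by_contra! hcon
  have hbc : b ≠ c := fun h => hc.2 (h ▸ hb)
  have h1 := h fun u => if u ∈ B then b else c
  have h2 : ({b, c} : Finset V) ⊆ U.image fun u => if u ∈ B then b else c := by
    intro v hv
    rcases Finset.mem_insert.1 hv with rfl | hv
    · exact Finset.mem_image.2 ⟨v, hB hb, if_pos hb⟩
    · rw [Finset.mem_singleton] at hv
      subst hv
      exact Finset.mem_image.2 ⟨v, hc.1, if_neg hc.2⟩
  have h3 := Finset.card_le_card h2
  rw [Finset.card_pair hbc] at h3
  rw [Finset.sum_eq_zero] at h1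
  · have h4 := (Nat.cast_le (α := ℝ)).2 h3
    rw [Nat.cast_ofNat] at h4
    linarith
  · intro e he
    exfalso
    obtain ⟨he, hne⟩ := Finset.mem_filter.1 he
    rw [mem_edgesIn] at he
    by_cases h1 : s e ∈ B <;> by_cases h2 : t e ∈ B
    · simp [h1, h2] at hne
    · exact hcon e _ h1 _ (Finset.mem_sdiff.2 ⟨he.2, h2⟩) (Or.inl ⟨rfl, rfl⟩)
    · exact hcon e _ h2 _ (Finset.mem_sdiff.2 ⟨he.1, h1⟩) (Or.inr ⟨rfl, rfl⟩)
    · simp [h1, h2] at hne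

open Classical in
-- Extend `r` to a partition of all vertices: a vertex of `M₀` whose neighbours lie in one class
-- joins that class, every other vertex outside `S` is a singleton. Edges at an absorbed vertex stay
-- inside its class, and no edge meets two absorbed vertices, so the cuts of these vertices, worth
-- at least 2 each, can be added to the partition inequality. A crossing vertex counts only 1
-- instead of 2, whence the term `r.crossing N`.
theorem card_quotient_add_le_sum {S M₀ M₁ : Finset V} {x : ι → ℝ} (hx : ∀ e, 0 ≤ x e)
    (hS₀ : Disjoint S M₀) (hS₁ : Disjoint S M₁) (hM : Disjoint M₀ M₁)
    (hpart : PartitionBound s t (S ∪ M₀ ∪ M₁) x)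
    (hcut : ∀ v ∈ M₀, 2 ≤ ∑ e ∈ (edgesIn s t (S ∪ M₀ ∪ M₁)).filter
      fun e => ¬ (s e = v ↔ t e = v), x e)
    (N : M₀ → Finset S) (hN : ∀ v, (N v).Nonempty)
    (hadj : ∀ (v : M₀) e, ∀ u ∈ S ∪ M₀ ∪ M₁, Joins s t e v u → u ≠ v → ∃ h : u ∈ S, ⟨u, h⟩ ∈ N v)
    (r : Setoid S) :
    (Nat.card (Quotient r) + M₁.card + 2 * M₀.card : ℝ) ≤
      1 + ∑ e ∈ edgesIn s t (S ∪ M₀ ∪ M₁), x e + r.crossing N := by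
  set U := S ∪ M₀ ∪ M₁ with hU
  have hrep : ∀ {u v : S}, r u v → (Quotient.mk r u).out = (Quotient.mk r v).out := by
    intro u v h
    rw [Quotient.sound h]
  let f : V → V := fun u =>
    if hS : u ∈ S then ((Quotient.mk r ⟨u, hS⟩).out : S)
    else if h₀ : u ∈ M₀ then
      if r.Crosses (N ⟨u, h₀⟩) then u else ((Quotient.mk r (hN ⟨u, h₀⟩).choose).out : S)
    else u
  have hfS : ∀ u : S, f u = ((Quotient.mk r u).out : S) := fun u => dif_pos u.2
  have hfc : ∀ v : M₀, r.Crosses (N v) → f v = v := by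
    intro v hv
    have h1 : (v : V) ∉ S := Finset.disjoint_right.1 hS₀ v.2
    simp only [f, dif_neg h1, dif_pos v.2, Subtype.coe_eta, if_pos hv]
  have hfn : ∀ v : M₀, ¬ r.Crosses (N v) → ∀ u ∈ N v, f v = f u := by
    intro v hv u hu
    have h1 : (v : V) ∉ S := Finset.disjoint_right.1 hS₀ v.2
    rw [hfS]
    simp only [f, dif_neg h1, dif_pos v.2, Subtype.coe_eta, if_neg hv]
    simp only [Setoid.Crosses, not_not] at hv
    rw [hrep (hv _ (hN v).choose_spec _ hu)]
  have hf₁ : ∀ v ∈ M₁, f v = v := by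
    intro v hv
    have h1 : v ∉ S := Finset.disjoint_right.1 hS₁ hv
    have h2 : v ∉ M₀ := Finset.disjoint_right.1 hM hv
    simp only [f, dif_neg h1, dif_neg h2]
  let nc : Finset M₀ := Finset.univ.filter fun v => ¬ r.Crosses (N v)
  let cr : Finset M₀ := Finset.univ.filter fun v => r.Crosses (N v)
  have hcr : r.crossing N = cr.card := by
    rw [Finset.card_filter]; rfl
  have hnc : cr.card + nc.card = M₀.card := by
    rw [Finset.card_filter_add_card_filter_not, Finset.card_univ, Fintype.card_coe]
  have hcard : Nat.card (Quotient r) + cr.card + M₁.card ≤ (U.image f).card := by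
    let A : Finset V := Finset.univ.image fun p : Quotient r => (p.out : V)
    let B : Finset V := cr.map (Function.Embedding.subtype _)
    have hAS : A ⊆ S := by
      intro v hv
      obtain ⟨p, -, rfl⟩ := Finset.mem_image.1 hv
      exact p.out.2
    have hBM : B ⊆ M₀ := by
      intro v hv
      obtain ⟨p, -, rfl⟩ := Finset.mem_map.1 hv
      exact p.2
    have hA : A.card = Nat.card (Quotient r) := by
      rw [Finset.card_image_of_injective, Finset.card_univ, Nat.card_eq_fintype_card]
      intro p p' hpp
      rw [← Quotient.out_eq p, ← Quotient.out_eq p', Subtype.ext hpp]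
    have hAB : Disjoint A B := Finset.disjoint_of_subset_left hAS
      (Finset.disjoint_of_subset_right hBM hS₀)
    have hABM : Disjoint (A ∪ B) M₁ := Finset.disjoint_union_left.2
      ⟨Finset.disjoint_of_subset_left hAS hS₁, Finset.disjoint_of_subset_left hBM hM⟩
    rw [← hA, ← Finset.card_map (s := cr) (Function.Embedding.subtype _),
      ← Finset.card_union_of_disjoint hAB, ← Finset.card_union_of_disjoint hABM]
    refine Finset.card_le_card fun v hv => ?_
    rcases Finset.mem_union.1 hv with hv | hv
    · rcases Finset.mem_union.1 hv with hv | hv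
      · obtain ⟨p, -, rfl⟩ := Finset.mem_image.1 hv
        refine Finset.mem_image.2 ⟨p.out, by simp [hU], ?_⟩
        rw [hfS, Quotient.out_eq]
      · obtain ⟨p, hp, rfl⟩ := Finset.mem_map.1 hv
        refine Finset.mem_image.2 ⟨p, by simp [hU], ?_⟩
        exact hfc p (Finset.mem_filter.1 hp).2
    · exact Finset.mem_image.2 ⟨v, by simp [hU, hv], hf₁ v hv⟩
  have hsum : ∑ e ∈ (edgesIn s t U).filter (fun e => f (s e) ≠ f (t e)), x e + 2 * (nc.card : ℝ) ≤
      ∑ e ∈ edgesIn s t U, x e := by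
    have h1 : 2 * (nc.card : ℝ) ≤ ∑ v ∈ nc, ∑ e ∈ (edgesIn s t U).filter
        (fun e => ¬ (s e = (v : V) ↔ t e = (v : V))), x e := by
      have := Finset.card_nsmul_le_sum nc (fun v => ∑ e ∈ (edgesIn s t U).filter
        (fun e => ¬ (s e = (v : V) ↔ t e = (v : V))), x e) 2 (fun v _ => hcut v v.2)
      rw [nsmul_eq_mul] at this
      linarith
    refine (add_le_add_right h1 _).trans ?_
    simp only [Finset.sum_filter]
    rw [Finset.sum_comm, ← Finset.sum_add_distrib]
    refine Finset.sum_le_sum fun e he => ?_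
    rw [mem_edgesIn] at he
    -- An edge at an absorbed vertex `v` has its other end in `S` and in the same class, so it
    -- counts in the cut of `v` alone.
    by_cases hD : ∃ v ∈ nc, ¬ (s e = (v : V) ↔ t e = (v : V))
    · obtain ⟨v, hv, hve⟩ := hD
      have hjoin : ∃ u ∈ U, Joins s t e v u ∧ u ≠ v := by
        by_cases h : s e = v
        · exact ⟨t e, he.2, Or.inl ⟨h, rfl⟩, fun h' => hve (by simp [h, h'])⟩
        · have h' : t e = v := by tauto
          exact ⟨s e, he.1, Or.inr ⟨rfl, h'⟩, h⟩
      obtain ⟨u, hu, hj, hne⟩ := hjoin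
      obtain ⟨huS, huN⟩ := hadj v e u hu hj hne
      have hfuv : f v = f u := hfn v (Finset.mem_filter.1 hv).2 _ huN
      have hfe : f (s e) = f (t e) := by
        rcases hj with ⟨h1, h2⟩ | ⟨h1, h2⟩ <;> rw [h1, h2, hfuv]
      rw [if_neg (not_not.2 hfe), zero_add, Finset.sum_eq_single_of_mem v hv, if_pos hve]
      intro w _ hwv
      refine if_neg (not_not.2 ?_)
      have hw1 : (v : V) ≠ w := fun h => hwv (Subtype.ext h.symm)
      have hw2 : u ≠ w := fun h => Finset.disjoint_left.1 hS₀ huS (h ▸ w.2)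
      rcases hj with ⟨h1, h2⟩ | ⟨h1, h2⟩ <;> rw [h1, h2] <;> tauto
    · push Not at hD
      rw [Finset.sum_eq_zero fun v hv => if_neg (not_not.2 (hD v hv)), add_zero]
      split_ifs
      · exact le_rfl
      · exact hx e
  have hp := hpart f
  have hcard' : (Nat.card (Quotient r) + cr.card + M₁.card : ℝ) ≤ ((U.image f).card : ℝ) := by
    exact_mod_cast hcard
  have hnc' : (cr.card : ℝ) + nc.card = M₀.card := by exact_mod_cast hnc
  rw [hcr]
  linarith

end EdgeEnds

/-! ### Graphs without cut vertices -/

namespace EdgeEnds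

variable {V ι : Type*} {s t : ι → V} [DecidableEq V] [Fintype ι]

theorem single_add_self_eq_zero (v : V) (a : ZMod 2) :
    (Pi.single v a : V → ZMod 2) + Pi.single v a = 0 := by
  rw [← Pi.single_add, CharTwo.add_self_eq_zero, Pi.single_zero]

open Classical in
-- With `q` components of the chosen pairs, the two candidates have at most `a + m₁ + 2m₀` and `b +
-- m₁ + 2m₀ + q - 1` edges. As `a + b ≤ 2|S| - 2`, their sum is at most `2(|S| + m₀ + m₁ - 1) + (2m₀
-- + q - 1)`. The first bracket is at most `x(E)` by the partition into singletons, the second by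
-- `card_quotient_add_le_sum`.
theorem exists_join_of_conn_erase {U : Finset V} (hU : U.Nonempty) {T : V → ZMod 2}
    (hT : EvenOn U T) {x : ι → ℝ} (hx : ∀ e, 0 ≤ x e) (hcut : CutBound s t U T x)
    (hpart : PartitionBound s t U x) (hconn : ∀ c ∈ U, Conn s t (U.erase c)) :
    ∃ L, IsJoin s t U T L ∧ Spans s t U L ∧ 2 * (L.card : ℝ) ≤ 3 * ∑ e ∈ edgesIn s t U, x e := by
  obtain ⟨S, hSU, hSne, ⟨a, b, hab, hjoin⟩, hind⟩ :=
    exists_earBuilt_independent hU hpart.conn hconn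
  set M₀ := (U \ S).filter fun v => T v = 0 with hM₀
  set M₁ := (U \ S).filter fun v => ¬ T v = 0 with hM₁
  have hUM : S ∪ M₀ ∪ M₁ = U := by
    rw [Finset.union_assoc, Finset.filter_union_filter_not_eq, Finset.union_sdiff_of_subset hSU]
  have hS₀ : Disjoint S M₀ := Finset.disjoint_of_subset_right (Finset.filter_subset _ _)
    Finset.disjoint_sdiff
  have hS₁ : Disjoint S M₁ := Finset.disjoint_of_subset_right (Finset.filter_subset _ _)
    Finset.disjoint_sdiff
  have hM : Disjoint M₀ M₁ := Finset.disjoint_filter_filter_not _ _ _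
  have hM₀D : ∀ v ∈ M₀, v ∈ U \ S := fun v hv => (Finset.mem_filter.1 hv).1
  have hM₁D : ∀ v ∈ M₁, v ∈ U \ S := fun v hv => (Finset.mem_filter.1 hv).1
  have hadj : ∀ v ∈ U \ S, ∀ e, ∀ u ∈ U, Joins s t e v u → u ≠ v → u ∈ S := by
    intro v hv e u hu hj hne
    by_contra huS
    exact hne (hind e v hv u (Finset.mem_sdiff.2 ⟨hu, huS⟩) hj).symm
  have hneU : ∀ v ∈ U \ S, ({v} : Finset V) ≠ U := by
    rintro v hv h
    obtain ⟨z, hz⟩ := hSne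
    have hzU := hSU hz
    rw [← h, Finset.mem_singleton] at hzU
    exact (Finset.mem_sdiff.1 hv).2 (hzU ▸ hz)
  have hnbr : ∀ v ∈ U \ S, ∃ e, ∃ u ∈ S, Joins s t e v u := by
    intro v hv
    obtain ⟨e, u, hu, w, hw, hj⟩ := hpart.conn {v}
      (Finset.singleton_subset_iff.2 (Finset.mem_sdiff.1 hv).1) ⟨v, by simp⟩ (hneU v hv)
    rw [Finset.mem_singleton] at hu
    subst hu
    rw [Finset.mem_sdiff, Finset.mem_singleton] at hw
    exact ⟨e, w, hadj u hv e w hw.1 hj hw.2, hj⟩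
  let N : M₀ → Finset S := fun v => Finset.univ.filter fun u => ∃ e, Joins s t e v u
  have hN : ∀ v, (N v).Nonempty := by
    intro v
    obtain ⟨e, u, hu, hj⟩ := hnbr v (hM₀D v v.2)
    exact ⟨⟨u, hu⟩, Finset.mem_filter.2 ⟨Finset.mem_univ _, e, hj⟩⟩
  obtain ⟨a', b', hab', r, hr⟩ := Setoid.exists_pairs_card_add_crossing_le N hN
  have hLP := card_quotient_add_le_sum (s := s) (t := t) (x := x) hx hS₀ hS₁ hM (hUM.symm ▸ hpart)
    (fun v hv => by
      have h := hcut {v} (Finset.singleton_subset_iff.2 (Finset.mem_sdiff.1 (hM₀D v hv)).1)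
        ⟨v, by simp⟩ (hneU v (hM₀D v hv)) (by simpa using (Finset.mem_filter.1 hv).2)
      rw [hUM]
      simpa only [Finset.mem_singleton] using h) N hN
    (fun v e u hu hj hne => by
      have huS := hadj v (hM₀D v v.2) e u (hUM ▸ hu) hj hne
      exact ⟨huS, Finset.mem_filter.2 ⟨Finset.mem_univ _, e, hj⟩⟩) r
  rw [hUM] at hLP
  have hea : ∀ v : M₀, ∃ e, Joins s t e v (a' v) := fun v => (Finset.mem_filter.1 (hab' v).1).2
  have heb : ∀ v : M₀, ∃ e, Joins s t e v (b' v) := fun v => (Finset.mem_filter.1 (hab' v).2).2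
  choose ea hea using hea
  choose eb heb using heb
  have hf : ∀ v : M₁, ∃ e, ∃ u ∈ S, Joins s t e v u := fun v => hnbr v (hM₁D v v.2)
  choose f p hpS hf using hf
  -- One edge at each terminal and two at each non-terminal make all parities outside `S` correct.
  -- The two edges may be the same edge taken twice.
  let LM : Multiset ι := ∑ v : M₁, {f v} + ∑ v : M₀, ({ea v} + {eb v})
  have hfLM : ∀ v, f v ∈ LM := fun v => Multiset.mem_add.2 (Or.inl
    (Multiset.mem_sum.2 ⟨v, Finset.mem_univ _, Multiset.mem_singleton_self _⟩))
  have haLM : ∀ v, ea v ∈ LM := fun v => Multiset.mem_add.2 (Or.inr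
    (Multiset.mem_sum.2 ⟨v, Finset.mem_univ _, by simp⟩))
  have hbLM : ∀ v, eb v ∈ LM := fun v => Multiset.mem_add.2 (Or.inr
    (Multiset.mem_sum.2 ⟨v, Finset.mem_univ _, by simp⟩))
  have hLMin : ∀ e ∈ LM, s e ∈ U ∧ t e ∈ U := by
    intro e he
    rcases Multiset.mem_add.1 he with he | he
    · obtain ⟨v, -, hv⟩ := Multiset.mem_sum.1 he
      rw [Multiset.mem_singleton] at hv
      exact hv ▸ (hf v).ends_mem (Finset.mem_sdiff.1 (hM₁D v v.2)).1 (hSU (hpS v))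
    · obtain ⟨v, -, hv⟩ := Multiset.mem_sum.1 he
      have hvU := (Finset.mem_sdiff.1 (hM₀D v v.2)).1
      rcases Multiset.mem_add.1 hv with hv | hv <;> rw [Multiset.mem_singleton] at hv
      · exact hv ▸ (hea v).ends_mem hvU (hSU (a' v).2)
      · exact hv ▸ (heb v).ends_mem hvU (hSU (b' v).2)
  have hLMcard : LM.card = M₁.card + 2 * M₀.card := by
    simp [LM, mul_comm]
  have hLMlink : ∀ v ∈ U \ S, ∃ u ∈ S, linked s t LM v u := by
    intro v hv
    by_cases h : T v = 0
    · have hv₀ : v ∈ M₀ := Finset.mem_filter.2 ⟨hv, h⟩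
      exact ⟨a' ⟨v, hv₀⟩, (a' ⟨v, hv₀⟩).2, linked_of_mem (haLM ⟨v, hv₀⟩) (hea _)⟩
    · have hv₁ : v ∈ M₁ := Finset.mem_filter.2 ⟨hv, h⟩
      exact ⟨p ⟨v, hv₁⟩, hpS _, linked_of_mem (hfLM ⟨v, hv₁⟩) (hf _)⟩
  have hLMb : ∀ w ∉ S, boundary s t LM w = T w := by
    intro w hw
    have hne : ∀ u ∈ S, w ≠ u := fun u hu h => hw (h ▸ hu)
    have h1 : boundary s t LM = ∑ v : M₁, (Pi.single (v : V) 1 + Pi.single (p v) 1) +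
        ∑ v : M₀, (Pi.single (a' v : V) 1 + Pi.single (b' v : V) 1) := by
      simp only [LM, map_add, map_sum]
      congr 1
      · exact Finset.sum_congr rfl fun v _ => boundary_singleton (hf v)
      · refine Finset.sum_congr rfl fun v _ => ?_
        rw [boundary_singleton (hea v), boundary_singleton (heb v)]
        linear_combination single_add_self_eq_zero (v : V) 1
    rw [h1, Pi.add_apply, Finset.sum_apply, Finset.sum_apply,
      Finset.sum_eq_zero (s := (Finset.univ : Finset M₀)), add_zero]
    · have h2 : ∀ v : M₁, ((Pi.single (v : V) 1 + Pi.single (p v) 1 : V → ZMod 2)) w =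
          if (v : V) = w then 1 else 0 := by
        intro v
        rw [Pi.add_apply, Pi.single_eq_of_ne (hne _ (hpS v)), add_zero, Pi.single_apply]
        simp only [eq_comm]
      rw [Finset.sum_congr rfl fun v _ => h2 v]
      by_cases hw₁ : w ∈ M₁
      · rw [Finset.sum_eq_single_of_mem ⟨w, hw₁⟩ (Finset.mem_univ _), if_pos rfl]
        · exact ((zmod_two_cases _).resolve_left (Finset.mem_filter.1 hw₁).2).symm
        · exact fun v _ hv => if_neg fun h => hv (Subtype.ext h)
      · have h3 : ∀ v : M₁, (v : V) ≠ w := fun v h => hw₁ (h ▸ v.2)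
        rw [Finset.sum_eq_zero fun v _ => if_neg (h3 v)]
        by_contra hTw
        have hwU : w ∈ U := by
          by_contra hwU
          exact hTw (hT.1 w hwU).symm
        exact hw₁ (Finset.mem_filter.2 ⟨Finset.mem_sdiff.2 ⟨hwU, hw⟩, fun h => hTw h.symm⟩)
    · intro v _
      rw [Pi.add_apply, Pi.single_eq_of_ne (hne _ (a' v).2), Pi.single_eq_of_ne (hne _ (b' v).2),
        add_zero]
  have heven : ∀ K : Multiset ι, (∀ e ∈ K, s e ∈ S ∧ t e ∈ S) →
      EvenOn S (T + boundary s t (LM + K)) := by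
    intro K hK
    have hE := evenOn_boundary (S := U) hLMin
    have hEK := evenOn_boundary hK
    have h0 : ∀ v ∉ S, (T + boundary s t LM) v = 0 := fun v hv => by
      rw [Pi.add_apply, hLMb v hv, CharTwo.add_self_eq_zero]
    have hsum : ∑ v ∈ S, (T + boundary s t LM) v = 0 := by
      rw [Finset.sum_subset hSU fun v _ hv => h0 v hv]
      simp only [Pi.add_apply, Finset.sum_add_distrib, hT.2, hE.2, add_zero]
    rw [map_add, ← add_assoc]
    refine ⟨fun v hv => by rw [Pi.add_apply, h0 v hv, hEK.1 v hv, add_zero], ?_⟩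
    simp only [Pi.add_apply (T + boundary s t LM), Finset.sum_add_distrib, hsum, hEK.2, add_zero]
  have hback : ∀ K : Multiset ι, (∀ e ∈ K, s e ∈ S ∧ t e ∈ S) → ∀ L,
      IsJoin s t S (T + boundary s t (LM + K)) L → IsJoin s t U T (L + (LM + K)) := by
    intro K hK L hL
    have h := hL.add (S' := U) (L' := LM + K) ⟨fun e he => ?_, rfl⟩
    · rw [Finset.union_eq_right.2 hSU, add_assoc] at h
      convert h using 1
      ext v
      simp [CharTwo.add_self_eq_zero]
    · rcases Multiset.mem_add.1 he with he | he
      · exact hLMin e he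
      · exact ⟨hSU (hK e he).1, hSU (hK e he).2⟩
  have hspan : ∀ L, LM ⊆ L → Spans s t S L → Spans s t U L := by
    intro L hL hspan
    obtain ⟨z, hz⟩ := hSne
    refine spans_of_root z fun v hv => ?_
    by_cases hvS : v ∈ S
    · exact hspan v hvS z hz
    · obtain ⟨u, hu, hlink⟩ := hLMlink v (Finset.mem_sdiff.2 ⟨hv, hvS⟩)
      exact Setoid.trans' _ (linked_mono hL hlink) (hspan u hu z hz)
  obtain ⟨L₁, hL₁, hsp₁, hc₁⟩ := (hjoin _ (heven 0 (by simp))).1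
  -- The connected join for the empty terminal set serves only as a stock of edges connecting `S`.
  obtain ⟨L₀, hL₀, hsp₀, -⟩ := (hjoin 0 ⟨by simp, by simp⟩).1
  obtain ⟨K, hK, hKcard, hKspan⟩ := exists_connectors hSne hL₀.inside hsp₀ (linked s t LM)
  obtain ⟨L₂, hL₂, hc₂⟩ := (hjoin _ (heven K hK)).2
  -- Each non-terminal `v` links `a' v` to `b' v`, so `LM` induces on `S` at most as many classes as
  -- the pairs do.
  have hc : Nat.card (Quotient ((linked s t LM).comap (Subtype.val : S → V))) ≤
      Nat.card (Quotient (Setoid.ofPairs a' b')) := by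
    refine Setoid.card_quotient_le_of_le (Setoid.eqvGen_le ?_)
    rintro _ _ ⟨v, rfl, rfl⟩
    exact Setoid.trans' (linked s t LM)
      (Setoid.symm' _ (linked_of_mem (haLM v) (hea v))) (linked_of_mem (hbLM v) (heb v))
  have hcardU : U.card = S.card + M₀.card + M₁.card := by
    rw [← Finset.card_union_of_disjoint hS₀, ← Finset.card_union_of_disjoint
      (Finset.disjoint_union_left.2 ⟨hS₁, hM⟩), hUM]
  have hn : (U.card : ℝ) ≤ 1 + ∑ e ∈ edgesIn s t U, x e := by
    have h := hpart id
    rw [Finset.image_id] at h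
    refine h.trans (add_le_add_right (Finset.sum_le_sum_of_subset_of_nonneg
      (Finset.filter_subset _ _) fun e _ _ => hx e) _)
  have hA := hback 0 (by simp) L₁ hL₁
  have hB := hback K hK L₂ hL₂
  have hspA : Spans s t U (L₁ + (LM + 0)) :=
    hspan _ (fun e he => by simp [he]) (hsp₁.mono fun e he => by simp [he])
  have hspB : Spans s t U (L₂ + (LM + K)) := by
    refine hspan _ (fun e he => by simp [he]) fun u hu v hv => ?_
    have : linked s t LM ⊔ linked s t K ≤ linked s t (L₂ + (LM + K)) :=
      sup_le (linked_mono fun e he => by simp [he]) (linked_mono fun e he => by simp [he])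
    exact this (hKspan u hu v hv)
  have hcardA : (L₁ + (LM + 0)).card ≤ a + (M₁.card + 2 * M₀.card) := by
    rw [Multiset.card_add, add_zero, hLMcard]; omega
  have hcardB : (L₂ + (LM + K)).card + 1 ≤
      b + (M₁.card + 2 * M₀.card) + Nat.card (Quotient (Setoid.ofPairs a' b')) := by
    rw [Multiset.card_add, Multiset.card_add, hLMcard]; omega
  have hr' : (Nat.card (Quotient (Setoid.ofPairs a' b')) + r.crossing N : ℝ) ≤
      Nat.card (Quotient r) := by exact_mod_cast hr
  have hcardA' : ((L₁ + (LM + 0)).card : ℝ) ≤ a + (M₁.card + 2 * M₀.card) := by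
    exact_mod_cast hcardA
  have hcardB' : ((L₂ + (LM + K)).card : ℝ) + 1 ≤
      b + (M₁.card + 2 * M₀.card) + Nat.card (Quotient (Setoid.ofPairs a' b')) := by
    exact_mod_cast hcardB
  have hab' : (a : ℝ) + b + 2 ≤ 2 * S.card := by exact_mod_cast hab
  have hcardU' : (U.card : ℝ) = S.card + M₀.card + M₁.card := by exact_mod_cast hcardU
  have hM₁0 : (0 : ℝ) ≤ M₁.card := Nat.cast_nonneg _
  by_cases hle : 2 * ((L₁ + (LM + 0)).card : ℝ) ≤ 3 * ∑ e ∈ edgesIn s t U, x e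
  · exact ⟨_, hA, hspA, hle⟩
  · exact ⟨_, hB, hspB, by linarith⟩

-- Splitting at a cut vertex

end EdgeEnds

namespace EdgeEnds

variable {V ι : Type*} {s t : ι → V} [DecidableEq V] [Fintype ι]

/-- The even subset of `insert c B` which agrees with `T` on `B`. -/
def restrictAt (T : V → ZMod 2) (c : V) (B : Finset V) (v : V) : ZMod 2 :=
  if v ∈ B then T v else if v = c then ∑ u ∈ B, T u else 0

theorem sum_restrictAt_of_subset (T : V → ZMod 2) (c : V) {B W : Finset V} (h : W ⊆ B) :
    ∑ v ∈ W, restrictAt T c B v = ∑ v ∈ W, T v :=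
  Finset.sum_congr rfl fun _ hv => if_pos (h hv)

theorem evenOn_restrictAt (T : V → ZMod 2) {c : V} {B : Finset V} (hc : c ∉ B) :
    EvenOn (insert c B) (restrictAt T c B) := by
  refine ⟨fun v hv => ?_, ?_⟩
  · rw [Finset.mem_insert, not_or] at hv
    rw [restrictAt, if_neg hv.2, if_neg hv.1]
  · rw [Finset.sum_insert hc, sum_restrictAt_of_subset T c subset_rfl, restrictAt, if_neg hc,
      if_pos rfl, CharTwo.add_self_eq_zero]

/-- A subset of `B` has the same cut in the smaller graph as in the whole one, since no edge joins
`B` to `C`. A set containing `c` is replaced by its complement in `insert c B`, which has the same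
cut and again an even number of terminals. -/
theorem CutBound.restrict {B C : Finset V} {c : V} {T : V → ZMod 2} {x : ι → ℝ}
    (hx : ∀ e, 0 ≤ x e) (hcB : c ∉ B) (hno : ∀ e, ∀ u ∈ B, ∀ v ∈ C, ¬ Joins s t e u v)
    (h : CutBound s t (insert c (B ∪ C)) T x) :
    CutBound s t (insert c B) (restrictAt T c B) x := by
  have key : ∀ W ⊆ B, W.Nonempty → ∑ v ∈ W, restrictAt T c B v = 0 →
      2 ≤ ∑ e ∈ (edgesIn s t (insert c B)).filter fun e => ¬ (s e ∈ W ↔ t e ∈ W), x e := by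
    intro W hW hne hsum
    rw [sum_restrictAt_of_subset T c hW] at hsum
    refine (h W (hW.trans fun v hv => by simp [hv]) hne (fun hWU => hcB (hW ?_)) hsum).trans ?_
    · rw [hWU]; exact Finset.mem_insert_self _ _
    · refine Finset.sum_le_sum_of_subset_of_nonneg (fun e he => ?_) fun e _ _ => hx e
      obtain ⟨he, hcr⟩ := Finset.mem_filter.1 he
      rw [mem_edgesIn] at he
      refine Finset.mem_filter.2 ⟨mem_edgesIn.2 ?_, hcr⟩
      have hmem : ∀ v ∈ insert c (B ∪ C), v ∉ C → v ∈ insert c B := by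
        intro v hv hvC
        simp only [Finset.mem_insert, Finset.mem_union] at hv ⊢
        tauto
      by_cases h1 : s e ∈ W
      · exact ⟨Finset.mem_insert_of_mem (hW h1), hmem _ he.2 fun h2 =>
          hno e _ (hW h1) _ h2 (Or.inl ⟨rfl, rfl⟩)⟩
      · have h3 : t e ∈ W := by tauto
        exact ⟨hmem _ he.1 fun h2 => hno e _ (hW h3) _ h2 (Or.inr ⟨rfl, rfl⟩),
          Finset.mem_insert_of_mem (hW h3)⟩
  intro W hW hne hWU hsum
  by_cases hcW : c ∈ W
  · have hsub : insert c B \ W ⊆ B := by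
      intro v hv
      rw [Finset.mem_sdiff, Finset.mem_insert] at hv
      exact hv.1.resolve_left fun h => hv.2 (h ▸ hcW)
    have h1 := key (insert c B \ W) hsub ?_ ?_
    · convert h1 using 2
      refine Finset.filter_congr fun e he => not_congr ?_
      rw [mem_edgesIn] at he
      rw [Finset.mem_sdiff, Finset.mem_sdiff]
      tauto
    · rw [Finset.sdiff_nonempty]
      exact fun h => hWU (hW.antisymm h)
    · have h2 := (evenOn_restrictAt T hcB).2
      rwa [← Finset.sum_sdiff hW, hsum, add_zero] at h2
  · exact key W (fun v hv => (Finset.mem_insert.1 (hW hv)).resolve_left fun h => hcW (h ▸ hv))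
      hne hsum

/-- Colouring `C` like `c` makes every edge with an end in `C` monochromatic. -/
theorem PartitionBound.restrict {B C : Finset V} {c : V} {x : ι → ℝ}
    (hx : ∀ e, 0 ≤ x e) (hcC : c ∉ C) (hBC : Disjoint B C)
    (hno : ∀ e, ∀ u ∈ B, ∀ v ∈ C, ¬ Joins s t e u v)
    (h : PartitionBound s t (insert c (B ∪ C)) x) : PartitionBound s t (insert c B) x := by
  intro f
  have h1 := h fun u => if u ∈ C then f c else f u
  have hf : ∀ u ∈ insert c B, (if u ∈ C then f c else f u) = f u := by
    intro u hu
    refine if_neg fun huC => ?_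
    rcases Finset.mem_insert.1 hu with rfl | hu
    · exact hcC huC
    · exact Finset.disjoint_left.1 hBC hu huC
  have h2 : (insert c B).image f ⊆
      (insert c (B ∪ C)).image fun u => if u ∈ C then f c else f u := by
    intro v hv
    obtain ⟨u, hu, rfl⟩ := Finset.mem_image.1 hv
    refine Finset.mem_image.2 ⟨u, ?_, hf u hu⟩
    simp only [Finset.mem_insert, Finset.mem_union] at hu ⊢
    tauto
  refine ((Nat.cast_le (α := ℝ)).2 (Finset.card_le_card h2)).trans (h1.trans ?_)
  refine add_le_add_right (Finset.sum_le_sum_of_subset_of_nonneg (fun e he => ?_)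
    fun e _ _ => hx e) _
  obtain ⟨he, hne⟩ := Finset.mem_filter.1 he
  rw [mem_edgesIn] at he
  have hCc : ∀ v ∈ insert c (B ∪ C), v ∉ insert c B → v ∈ C := by
    intro v hv hv'
    simp only [Finset.mem_insert, Finset.mem_union] at hv hv'
    tauto
  have hC : ∀ u v, u ∈ insert c (B ∪ C) → v ∈ C → Joins s t e u v →
      (if u ∈ C then f c else f u) = f c := by
    intro u v hu hv hj
    split_ifs with huC
    · rfl
    · simp only [Finset.mem_insert, Finset.mem_union] at hu
      obtain rfl | hu | hu := hu
      · rfl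
      · exact absurd hj (hno e u hu v hv)
      · exact absurd hu huC
  by_cases hs : s e ∈ insert c B
  · by_cases ht : t e ∈ insert c B
    · refine Finset.mem_filter.2 ⟨mem_edgesIn.2 ⟨hs, ht⟩, ?_⟩
      rwa [hf _ hs, hf _ ht] at hne
    · refine absurd ?_ hne
      have ht' := hCc _ he.2 ht
      rw [hC _ _ he.1 ht' (Or.inl ⟨rfl, rfl⟩), if_pos ht']
  · refine absurd ?_ hne
    have hs' := hCc _ he.1 hs
    rw [hC _ _ he.2 hs' (Or.inr ⟨rfl, rfl⟩), if_pos hs']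

/-- A point that satisfies the cut and partition constraints yields a connected join of at most
`3/2` times its size. -/
theorem exists_spanning_join (hloop : ∀ e, s e ≠ t e) {x : ι → ℝ} (hx : ∀ e, 0 ≤ x e)
    {U : Finset V} (hU : U.Nonempty) {T : V → ZMod 2} (hT : EvenOn U T) (hcut : CutBound s t U T x)
    (hpart : PartitionBound s t U x) :
    ∃ L, IsJoin s t U T L ∧ Spans s t U L ∧ 2 * (L.card : ℝ) ≤ 3 * ∑ e ∈ edgesIn s t U, x e := by
  induction hn : U.card using Nat.strong_induction_on generalizing U T with
  | _ n ih =>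
  by_cases hall : ∀ c ∈ U, Conn s t (U.erase c)
  · exact exists_join_of_conn_erase hU hT hx hcut hpart hall
  simp only [Conn] at hall
  push Not at hall
  -- Now `c` is a cut vertex separating `B` from the rest `C`. The two subproblems choose their
  -- parities at `c` to be even in total; these add up to `T c` because `T` is even on `U`.
  obtain ⟨c, hc, B, hBU, hBne, hB, hno⟩ := hall
  set C := U.erase c \ B with hC
  have hcB : c ∉ B := fun h => (Finset.mem_erase.1 (hBU h)).1 rfl
  have hcC : c ∉ C := fun h => (Finset.mem_erase.1 (Finset.mem_sdiff.1 h).1).1 rfl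
  have hBC : Disjoint B C := Finset.disjoint_sdiff
  have hCne : C.Nonempty := by
    rw [hC, Finset.sdiff_nonempty]
    exact fun h => hB (hBU.antisymm h)
  have hUeq : insert c (B ∪ C) = U := by
    rw [hC, Finset.union_sdiff_of_subset hBU, Finset.insert_erase hc]
  have hUeq' : insert c (C ∪ B) = U := by rw [Finset.union_comm, hUeq]
  have hno' : ∀ e, ∀ u ∈ C, ∀ v ∈ B, ¬ Joins s t e u v := fun e u hu v hv hj =>
    hno e v hv u hu hj.symm
  have hcard : U.card = B.card + C.card + 1 := by
    rw [← hUeq, Finset.card_insert_of_notMem (by simp [hcB, hcC]),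
      Finset.card_union_of_disjoint hBC]
  have hBpos := Finset.card_pos.2 hBne
  have hCpos := Finset.card_pos.2 hCne
  obtain ⟨L₁, hL₁, hsp₁, hc₁⟩ := ih (insert c B).card
    (by rw [Finset.card_insert_of_notMem hcB]; omega) (Finset.insert_nonempty c B)
    (evenOn_restrictAt T hcB) (CutBound.restrict hx hcB hno (hUeq.symm ▸ hcut))
    (PartitionBound.restrict hx hcC hBC hno (hUeq.symm ▸ hpart)) rfl
  obtain ⟨L₂, hL₂, hsp₂, hc₂⟩ := ih (insert c C).card
    (by rw [Finset.card_insert_of_notMem hcC]; omega) (Finset.insert_nonempty c C)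
    (evenOn_restrictAt T hcC) (CutBound.restrict hx hcC hno' (hUeq'.symm ▸ hcut))
    (PartitionBound.restrict hx hcB hBC.symm hno' (hUeq'.symm ▸ hpart)) rfl
  refine ⟨L₁ + L₂, ?_, ?_, ?_⟩
  · have h := hL₁.add hL₂
    have h1 : insert c B ∪ insert c C = U := by
      rw [← hUeq]; ext v; simp only [Finset.mem_union, Finset.mem_insert]; tauto
    have h2 : restrictAt T c B + restrictAt T c C = T := by
      ext v
      rw [Pi.add_apply]
      unfold restrictAt
      by_cases hvB : v ∈ B
      · have hvC := Finset.disjoint_left.1 hBC hvB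
        have hvc : v ≠ c := fun h => hcB (h ▸ hvB)
        simp [hvB, hvC, hvc]
      · by_cases hvC : v ∈ C
        · have hvc : v ≠ c := fun h => hcC (h ▸ hvC)
          simp [hvB, hvC, hvc]
        · by_cases hvc : v = c
          · subst hvc
            have hsum := hT.2
            rw [← hUeq, Finset.sum_insert (by simp [hcB, hcC]), Finset.sum_union hBC] at hsum
            rw [if_neg hvB, if_neg hvC, if_pos rfl, if_pos rfl]
            linear_combination hsum - CharTwo.add_self_eq_zero (T v)
          · have hvU : v ∉ U := by
              rw [← hUeq]; simp [hvB, hvC, hvc]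
            simp [hvB, hvC, hvc, hT.1 v hvU]
    rwa [h1, h2] at h
  · refine spans_of_root c fun v hv => ?_
    rw [← hUeq, Finset.mem_insert, Finset.mem_union] at hv
    have h1 : L₁ ⊆ L₁ + L₂ := fun e he => by simp [he]
    have h2 : L₂ ⊆ L₁ + L₂ := fun e he => by simp [he]
    obtain rfl | hv | hv := hv
    · exact Setoid.refl' _ _
    · exact hsp₁.mono h1 v (by simp [hv]) c (by simp)
    · exact hsp₂.mono h2 v (by simp [hv]) c (by simp)
  · have hsum : ∑ e ∈ edgesIn s t (insert c B), x e + ∑ e ∈ edgesIn s t (insert c C), x e ≤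
        ∑ e ∈ edgesIn s t U, x e := by
      classical
      rw [← Finset.sum_union]
      · refine Finset.sum_le_sum_of_subset_of_nonneg (fun e he => ?_) fun e _ _ => hx e
        rw [Finset.mem_union, mem_edgesIn, mem_edgesIn] at he
        rw [mem_edgesIn, ← hUeq]
        simp only [Finset.mem_insert, Finset.mem_union] at he ⊢
        tauto
      · rw [Finset.disjoint_left]
        intro e he he'
        rw [mem_edgesIn] at he he'
        have hmem : ∀ v, v ∈ insert c B → v ∈ insert c C → v = c := by
          intro v hv hv'
          by_contra hvc
          exact Finset.disjoint_left.1 hBC ((Finset.mem_insert.1 hv).resolve_left hvc)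
            ((Finset.mem_insert.1 hv').resolve_left hvc)
        -- Both sides share only the vertex `c`, so a common edge would be a loop.
        exact hloop e ((hmem _ he.1 he'.1).trans (hmem _ he.2 he'.2).symm)
    rw [Multiset.card_add]
    push_cast
    linarith

end EdgeEnds

/-! ### Cuts, parities and partitions in a `Graph` -/

namespace Graph

variable {α : Type u} {β : Type v} {G : Graph α β}

/-- One of the ends of an edge. -/
noncomputable def src (G : Graph α β) (e : E(G)) : α :=
  (G.exists_isLink_of_mem_edgeSet e.2).choose

/-- The other end of an edge. -/
noncomputable def tgt (G : Graph α β) (e : E(G)) : α :=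
  (G.exists_isLink_of_mem_edgeSet e.2).choose_spec.choose

theorem isLink_src_tgt (e : E(G)) : G.IsLink e (G.src e) (G.tgt e) :=
  (G.exists_isLink_of_mem_edgeSet e.2).choose_spec.choose_spec

theorem IsLink.mem_cut_iff {e : β} {x y : α} (h : G.IsLink e x y) {W : Set α} :
    e ∈ G.cut W ↔ ¬ (x ∈ W ↔ y ∈ W) := by
  constructor
  · rintro ⟨x', y', h', hx, hy⟩
    rcases h.eq_and_eq_or_eq_and_eq h' with ⟨rfl, rfl⟩ | ⟨rfl, rfl⟩ <;> tauto
  · intro hxy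
    by_cases hx : x ∈ W
    · exact ⟨x, y, h, hx, by tauto⟩
    · exact ⟨y, x, h.symm, by tauto, hx⟩

theorem cut_subset_edgeSet (W : Set α) : G.cut W ⊆ E(G) := fun _ ⟨_, _, h, _⟩ => h.edge_mem

theorem partitionCut_subset_edgeSet (𝒲 : Partition V(G)) : G.partitionCut 𝒲 ⊆ E(G) :=
  Set.iUnion₂_subset fun _ _ => cut_subset_edgeSet _

open Classical in
theorem edgeSum_eq_sum [Fintype E(G)] (x : E(G) → ℝ) (S : Set β) :
    G.edgeSum x S = ∑ e : E(G), if (e : β) ∈ S then x e else 0 := by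
  rw [edgeSum, finsum_mem_def, finsum_eq_sum_of_fintype]
  exact Finset.sum_congr rfl fun e _ => by simp [Set.indicator]

open Classical in
theorem ncard_inter_eq_sum {γ : Type*} {F : Set γ} (hF : F.Finite) (S : Set γ) :
    (S ∩ F).ncard = ∑ e ∈ hF.toFinset, if e ∈ S then 1 else 0 := by
  rw [← Finset.card_filter, ← Set.ncard_coe_finset]
  congr 1
  ext e
  simp [and_comm]

theorem edgeSum_incidenceVector (hE : E(G).Finite) {F : Set β} (hF : F ⊆ E(G)) (S : Set β) :
    G.edgeSum (G.incidenceVector F) S = (S ∩ F).ncard := by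
  classical
  have := hE.fintype
  have h : (S ∩ F).ncard = (S ∩ F ∩ E(G)).ncard := by
    rw [Set.inter_eq_left.2 (Set.inter_subset_right.trans hF)]
  rw [edgeSum_eq_sum, h, ncard_inter_eq_sum hE, Nat.cast_sum]
  rw [← Finset.sum_coe_sort hE.toFinset]
  refine Finset.sum_bij' (fun e _ => ⟨e, hE.mem_toFinset.2 e.2⟩)
    (fun e _ => ⟨e, hE.mem_toFinset.1 e.2⟩) ?_ ?_ ?_ ?_ ?_ <;> try simp
  intro e he
  by_cases h1 : e ∈ S <;> by_cases h2 : e ∈ F <;> simp [incidenceVector, h1, h2]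

theorem finsum_eq_edgeSum (x : E(G) → ℝ) : ∑ᶠ e, x e = G.edgeSum x E(G) := by
  rw [edgeSum]
  simp

theorem finsum_incidenceVector (hE : E(G).Finite) {F : Set β} (hF : F ⊆ E(G)) :
    ∑ᶠ e, G.incidenceVector F e = F.ncard := by
  rw [finsum_eq_edgeSum, edgeSum_incidenceVector hE hF, Set.inter_eq_right.2 hF]

/-- Handshake argument modulo 2: edges inside `W` are counted at both ends and cancel. -/
theorem natCast_ncard_cut_inter {F : Set β} (hE : F.Finite) (hF : F ⊆ E(G)) (W : Finset α) :
    ((G.cut W ∩ F).ncard : ZMod 2) = ∑ v ∈ W, ((G.cut {v} ∩ F).ncard : ZMod 2) := by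
  classical
  simp only [ncard_inter_eq_sum hE, Nat.cast_sum]
  rw [Finset.sum_comm]
  refine Finset.sum_congr rfl fun e he => ?_
  obtain ⟨x, y, h⟩ := G.exists_isLink_of_mem_edgeSet (hF (hE.mem_toFinset.1 he))
  have h1 : ∀ v, ((if e ∈ G.cut {v} then 1 else 0 : ℕ) : ZMod 2) =
      (if x = v then 1 else 0) + if y = v then 1 else 0 := by
    intro v
    simp only [h.mem_cut_iff, Set.mem_singleton_iff]
    by_cases hx : x = v <;> by_cases hy : y = v <;> simp [hx, hy, CharTwo.add_self_eq_zero]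
  rw [Finset.sum_congr rfl fun v _ => h1 v]
  simp only [Finset.sum_add_distrib, Finset.sum_ite_eq, h.mem_cut_iff, Finset.mem_coe]
  by_cases hx : x ∈ W <;> by_cases hy : y ∈ W <;> simp [hx, hy, CharTwo.add_self_eq_zero]

theorem natCast_eq_ite_odd (n : ℕ) : (n : ZMod 2) = if Odd n then 1 else 0 := by
  split_ifs with h
  · exact (ZMod.natCast_eq_one_iff_odd).2 h
  · exact (ZMod.natCast_eq_zero_iff_even).2 (Nat.not_odd_iff_even.1 h)

theorem natCast_ncard_inter (T : Set α) [DecidablePred (· ∈ T)] (W : Finset α) :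
    (((W : Set α) ∩ T).ncard : ZMod 2) = ∑ v ∈ W, if v ∈ T then 1 else 0 := by
  classical
  rw [Set.inter_comm, ncard_inter_eq_sum W.finite_toSet, Nat.cast_sum, Finset.finite_toSet_toFinset]
  exact Finset.sum_congr rfl fun v _ => by split_ifs <;> simp

theorem IsTJoin.natCast_ncard_cut_inter {T : Set α} {F : Set β} (h : G.IsTJoin T F)
    (hF : F.Finite) {W : Finset α} (hW : (W : Set α) ⊆ V(G)) :
    ((G.cut W ∩ F).ncard : ZMod 2) = (((W : Set α) ∩ T).ncard : ZMod 2) := by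
  classical
  rw [Graph.natCast_ncard_cut_inter hF h.1, natCast_ncard_inter]
  refine Finset.sum_congr rfl fun v hv => ?_
  rw [natCast_eq_ite_odd]
  refine if_congr ?_ rfl rfl
  conv_rhs => rw [h.2]
  exact ⟨fun h => ⟨hW hv, h⟩, fun h => h.2⟩

theorem partition_exists_mem (𝒲 : Partition V(G)) {v : α} (hv : v ∈ V(G)) : ∃ W ∈ 𝒲, v ∈ W := by
  have h := 𝒲.sSup_eq
  rw [Set.sSup_eq_sUnion] at h
  rw [← h] at hv
  exact hv

theorem partition_eq_of_mem (𝒲 : Partition V(G)) {v : α} {W W' : Set α} (hW : W ∈ 𝒲)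
    (hW' : W' ∈ 𝒲) (hv : v ∈ W) (hv' : v ∈ W') : W = W' :=
  𝒲.eq_of_not_disjoint hW hW' fun h => Set.disjoint_left.1 h hv hv'

theorem IsLink.mem_partitionCut_iff {𝒲 : Partition V(G)} {e : β} {x y : α} (h : G.IsLink e x y)
    {W W' : Set α} (hW : W ∈ 𝒲) (hW' : W' ∈ 𝒲) (hx : x ∈ W) (hy : y ∈ W') :
    e ∈ G.partitionCut 𝒲 ↔ W ≠ W' := by
  simp only [partitionCut, Set.mem_iUnion, exists_prop, h.mem_cut_iff]
  constructor
  · rintro ⟨A, hA, hc⟩ rfl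
    by_cases hxA : x ∈ A
    · have := partition_eq_of_mem 𝒲 hA hW hxA hx
      subst this
      tauto
    · have hyA : y ∈ A := by tauto
      have := partition_eq_of_mem 𝒲 hA hW hyA hy
      subst this
      tauto
  · intro hne
    refine ⟨W, hW, fun hc => hne ?_⟩
    exact partition_eq_of_mem 𝒲 hW hW' (hc.1 hx) hy

/-- A connected graph has at least `|𝒲| - 1` edges between the classes of a partition `𝒲`. -/
theorem ncard_partition_le {F : Set β} (hF : F.Finite) (hV : V(G).Finite)
    (hconn : (G.restrict F).Connected) (𝒲 : Partition V(G)) :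
    (𝒲 : Set (Set α)).ncard ≤ (G.partitionCut 𝒲 ∩ F).ncard + 1 := by
  classical
  let cls : α → Set α := fun v => if h : v ∈ V(G) then (partition_exists_mem 𝒲 h).choose else ∅
  have hcls : ∀ v ∈ V(G), cls v ∈ 𝒲 ∧ v ∈ cls v := by
    intro v hv
    simp only [cls, dif_pos hv]
    exact (partition_exists_mem 𝒲 hv).choose_spec
  have hfin : (𝒲 : Set (Set α)).Finite := by
    refine (hV.image cls).subset fun W hW => ?_
    obtain ⟨v, hv⟩ := Set.nonempty_iff_ne_empty.2 (𝒲.ne_bot_of_mem hW)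
    have hvV := 𝒲.le_of_mem hW hv
    exact ⟨v, hvV, partition_eq_of_mem 𝒲 (hcls v hvV).1 hW (hcls v hvV).2 hv⟩
  have := hfin.to_subtype
  -- `H` is the graph with the classes contracted. It inherits connectedness from `F`, and its edges
  -- are images of edges of `F` in the partition cut.
  let H : SimpleGraph (𝒲 : Set (Set α)) :=
    { Adj := fun A B => A ≠ B ∧ ∃ e ∈ F, ∃ x ∈ (A : Set α), ∃ y ∈ (B : Set α), G.IsLink e x y
      symm := ⟨fun A B ⟨hne, e, he, x, hx, y, hy, h⟩ =>
        ⟨hne.symm, e, he, y, hy, x, hx, h.symm⟩⟩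
      loopless := ⟨fun A h => h.1 rfl⟩ }
  have hreach : ∀ x y, Relation.ReflTransGen (G.restrict F).Adj x y → ∀ A B : (𝒲 : Set (Set α)),
      x ∈ (A : Set α) → y ∈ (B : Set α) → H.Reachable A B := by
    intro x y h
    induction h with
    | refl =>
      intro A B hA hB
      rw [Subtype.ext (partition_eq_of_mem 𝒲 A.2 B.2 hA hB)]
    | tail _ hyz ih =>
      intro A B hA hB
      obtain ⟨e, he, hl⟩ := hyz
      have hy := hcls _ hl.left_mem
      refine (ih A ⟨_, hy.1⟩ hA hy.2).trans ?_
      by_cases hEq : (⟨_, hy.1⟩ : (𝒲 : Set (Set α))) = B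
      · rw [hEq]
      · exact SimpleGraph.Adj.reachable (⟨hEq, e, he, _, hy.2, _, hB, hl⟩ : H.Adj _ _)
  have hH : H.Connected := by
    obtain ⟨v, hv⟩ := hconn.1
    have : Nonempty (𝒲 : Set (Set α)) := ⟨⟨cls v, (hcls v hv).1⟩⟩
    refine ⟨fun A B => ?_⟩
    obtain ⟨x, hx⟩ := Set.nonempty_iff_ne_empty.2 (𝒲.ne_bot_of_mem A.2)
    obtain ⟨y, hy⟩ := Set.nonempty_iff_ne_empty.2 (𝒲.ne_bot_of_mem B.2)
    exact hreach x y (hconn.2 x (𝒲.le_of_mem A.2 hx) y (𝒲.le_of_mem B.2 hy)) A B hx hy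
  have h1 := hH.card_vert_le_card_edgeSet_add_one
  have h2 : Nat.card H.edgeSet ≤ (G.partitionCut 𝒲 ∩ F).ncard := by
    let A₀ : (𝒲 : Set (Set α)) := hH.nonempty.some
    let φ : α → (𝒲 : Set (Set α)) := fun v => if h : v ∈ V(G) then ⟨cls v, (hcls v h).1⟩ else A₀
    let ψ : β → Sym2 (𝒲 : Set (Set α)) := fun e =>
      if h : e ∈ E(G) then s(φ (G.src ⟨e, h⟩), φ (G.tgt ⟨e, h⟩)) else s(A₀, A₀)
    have hsub : H.edgeSet ⊆ ψ '' (G.partitionCut 𝒲 ∩ F) := by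
      intro p
      induction p using Sym2.ind with
      | _ A B =>
      rintro ⟨hne, e, he, x, hx, y, hy, hl⟩
      refine ⟨e, ⟨(hl.mem_partitionCut_iff A.2 B.2 hx hy).2 fun h => hne (Subtype.ext h), he⟩, ?_⟩
      have hφ : ∀ (v : α) (C : (𝒲 : Set (Set α))), v ∈ (C : Set α) → φ v = C := by
        intro v C hv
        have hvV := 𝒲.le_of_mem C.2 hv
        simp only [φ, dif_pos hvV]
        exact Subtype.ext (partition_eq_of_mem 𝒲 (hcls v hvV).1 C.2 (hcls v hvV).2 hv)
      simp only [ψ, dif_pos hl.edge_mem]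
      have hst := isLink_src_tgt (⟨e, hl.edge_mem⟩ : E(G))
      rcases hst.eq_and_eq_or_eq_and_eq hl with ⟨h1, h2⟩ | ⟨h1, h2⟩
      · rw [h1, h2, hφ x A hx, hφ y B hy]
      · rw [h1, h2, hφ x A hx, hφ y B hy, Sym2.eq_swap]
    rw [Nat.card_coe_set_eq]
    have hfin' : (G.partitionCut 𝒲 ∩ F).Finite := hF.subset Set.inter_subset_right
    exact (Set.ncard_le_ncard hsub (hfin'.image ψ)).trans (Set.ncard_image_le hfin')
  rw [Nat.card_coe_set_eq] at h1
  omega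

end Graph

/-! ### From points of `P(2G, T)` to connected-`T`-joins -/

namespace Graph

variable {α : Type u} {β : Type v} {G : Graph α β}

/-- The partition of `A` into the colour classes of `f`. -/
def colourPartition (A : Set α) (f : α → α) : Partition A where
  parts := (fun c => {u ∈ A | f u = c}) '' (f '' A)
  sSupIndep' := by
    rw [sSupIndep_iff_pairwiseDisjoint]
    rintro _ ⟨c, -, rfl⟩ _ ⟨d, -, rfl⟩ hne
    refine Set.disjoint_left.2 fun u hu hu' => hne ?_
    rw [show c = d from hu.2.symm.trans hu'.2]
  bot_notMem' := by
    rintro ⟨_, ⟨v, hv, rfl⟩, h⟩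
    have : v ∈ (⊥ : Set α) := h ▸ ⟨hv, rfl⟩
    exact this
  sSup_eq' := by
    rw [Set.sSup_eq_sUnion]
    ext v
    simp only [Set.mem_sUnion, Set.mem_image, exists_exists_and_eq_and, Set.mem_ofPred_eq]
    exact ⟨fun ⟨_, _, h, _⟩ => h, fun h => ⟨v, h, h, rfl⟩⟩

theorem mem_colourPartition {A : Set α} {f : α → α} {W : Set α} :
    W ∈ colourPartition A f ↔ ∃ c ∈ f '' A, {u ∈ A | f u = c} = W := Iff.rfl

theorem ncard_colourPartition (A : Set α) (f : α → α) :
    ((colourPartition A f : Partition A) : Set (Set α)).ncard = (f '' A).ncard := by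
  refine Set.InjOn.ncard_image ?_
  rintro _ ⟨v, hv, rfl⟩ d - h
  exact (h.subset (show v ∈ {u ∈ A | f u = f v} from ⟨hv, rfl⟩)).2

theorem IsLink.mem_partitionCut_colourPartition {e : β} {x y : α} (h : G.IsLink e x y)
    (f : α → α) : e ∈ G.partitionCut (colourPartition V(G) f) ↔ f x ≠ f y := by
  have hmem : ∀ v ∈ V(G), {u ∈ V(G) | f u = f v} ∈ colourPartition V(G) f := fun v hv =>
    mem_colourPartition.2 ⟨f v, ⟨v, hv, rfl⟩, rfl⟩
  rw [h.mem_partitionCut_iff (hmem x h.left_mem) (hmem y h.right_mem) ⟨h.left_mem, rfl⟩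
    ⟨h.right_mem, rfl⟩]
  refine not_congr ⟨fun hW => ?_, fun hf => by rw [hf]⟩
  have : x ∈ {u ∈ V(G) | f u = f y} := hW ▸ ⟨h.left_mem, rfl⟩
  exact this.2

open Classical in
/-- The indicator function of a set of vertices. -/
noncomputable def parity (T : Set α) (v : α) : ZMod 2 := if v ∈ T then 1 else 0

theorem sum_parity (T : Set α) (W : Finset α) :
    ∑ v ∈ W, parity T v = (((W : Set α) ∩ T).ncard : ZMod 2) := by
  classical
  rw [natCast_ncard_inter]; rfl

theorem evenOn_parity (hV : V(G).Finite) {T : Set α} (hT : T ⊆ V(G)) (he : Even T.ncard) :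
    EdgeEnds.EvenOn hV.toFinset (parity T) := by
  refine ⟨fun v hv => if_neg fun h => hv (hV.mem_toFinset.2 (hT h)), ?_⟩
  rw [sum_parity, hV.coe_toFinset, Set.inter_eq_right.2 hT]
  exact ZMod.natCast_eq_zero_iff_even.2 he

section

variable [DecidableEq α] [Fintype E(G)]

theorem edgesIn_eq_univ (hV : V(G).Finite) :
    EdgeEnds.edgesIn G.src G.tgt hV.toFinset = Finset.univ := by
  ext e
  have h := isLink_src_tgt e
  simp [EdgeEnds.mem_edgesIn, h.left_mem, h.right_mem]

theorem cutBound_of_mem_polyP (hV : V(G).Finite) {T : Set α} {x : E(G) → ℝ}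
    (hx : x ∈ G.polyP T) : EdgeEnds.CutBound G.src G.tgt hV.toFinset (parity T) x := by
  classical
  intro W hW hne hWV hsum
  rw [sum_parity, ZMod.natCast_eq_zero_iff_even] at hsum
  have hsub : (W : Set α) ⊆ V(G) := fun v hv => hV.mem_toFinset.1 (hW hv)
  have h := hx.2.1 W (by exact_mod_cast hne) (hsub.ssubset_of_ne fun h => hWV (by
    ext v; simp [← h])) hsum
  rw [edgeSum_eq_sum, ← Finset.sum_filter] at h
  rw [edgesIn_eq_univ]
  convert h using 2
  ext e
  simp [(isLink_src_tgt e).mem_cut_iff]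

theorem partitionBound_of_mem_polyP (hV : V(G).Finite) {T : Set α} {x : E(G) → ℝ}
    (hx : x ∈ G.polyP T) : EdgeEnds.PartitionBound G.src G.tgt hV.toFinset x := by
  classical
  intro f
  have h := hx.2.2 (colourPartition V(G) f)
  rw [edgeSum_eq_sum, ← Finset.sum_filter, ncard_colourPartition] at h
  rw [edgesIn_eq_univ, ← Set.ncard_coe_finset, Finset.coe_image, hV.coe_toFinset]
  have h2 : (Finset.univ.filter fun e : E(G) => (e : β) ∈ G.partitionCut (colourPartition V(G) f)) =
      Finset.univ.filter fun e => f (G.src e) ≠ f (G.tgt e) := by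
    ext e
    simp [(isLink_src_tgt e).mem_partitionCut_colourPartition]
  rw [h2] at h
  linarith

end

theorem boundary_apply [DecidableEq α] (L : Multiset E(G)) (v : α) :
    EdgeEnds.boundary G.src G.tgt L v = (L.map fun e : E(G) => parity (G.cut {v}) (e : β)).sum := by
  induction L using Multiset.induction_on with
  | empty => simp
  | cons e L ih =>
    have h := isLink_src_tgt e
    rw [← Multiset.singleton_add, map_add, EdgeEnds.boundary_singleton (Or.inl ⟨rfl, rfl⟩),
      Pi.add_apply, ih, Multiset.map_add, Multiset.sum_add, Multiset.map_singleton,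
      Multiset.sum_singleton]
    congr 1
    simp only [parity, h.mem_cut_iff, Set.mem_singleton_iff, Pi.add_apply, Pi.single_apply,
      eq_comm (a := v)]
    by_cases hx : G.src e = v <;> by_cases hy : G.tgt e = v <;>
      simp [hx, hy, CharTwo.add_self_eq_zero]

theorem double_isLink {p : β × Bool} {x y : α} : G.double.IsLink p x y ↔ G.IsLink p.1 x y := Iff.rfl

theorem double_mem_cut {p : β × Bool} {W : Set α} : p ∈ G.double.cut W ↔ p.1 ∈ G.cut W := Iff.rfl

theorem mem_edgeSet_double {p : β × Bool} : p ∈ E(G.double) ↔ p.1 ∈ E(G) := Iff.rfl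

open Classical in
/-- At most two copies of every edge, with the same parities as in `L`. -/
noncomputable def reduceCopies (L : Multiset β) : Finset (β × Bool) :=
  (L.toFinset ×ˢ Finset.univ).filter fun p => p.2 = false ∨ Even (L.count p.1)

open Classical in
theorem sum_reduceCopies {M : Type*} [AddCommMonoid M] (L : Multiset β) (g : β → M) :
    ∑ p ∈ reduceCopies L, g p.1 =
      ∑ e ∈ L.toFinset, (if Even (L.count e) then 2 else 1) • g e := by
  rw [reduceCopies, Finset.sum_filter, Finset.sum_product]
  refine Finset.sum_congr rfl fun e _ => ?_
  rw [Fintype.sum_bool]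
  split_ifs <;> simp_all [two_nsmul]

theorem card_reduceCopies_le (L : Multiset β) : (reduceCopies L).card ≤ L.card := by
  classical
  rw [Finset.card_eq_sum_ones, sum_reduceCopies L fun _ => 1, ← Multiset.toFinset_sum_count_eq]
  refine Finset.sum_le_sum fun e he => ?_
  have h := Multiset.count_pos.2 (Multiset.mem_toFinset.1 he)
  split_ifs with h2
  · obtain ⟨k, hk⟩ := h2
    simp only [smul_eq_mul]
    omega
  · simp only [smul_eq_mul]; omega

theorem sum_reduceCopies_zmod (L : Multiset β) (g : β → ZMod 2) :
    ∑ p ∈ reduceCopies L, g p.1 = (L.map g).sum := by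
  classical
  rw [sum_reduceCopies, Finset.sum_multiset_map_count]
  refine Finset.sum_congr rfl fun e _ => ?_
  rw [nsmul_eq_mul, nsmul_eq_mul]
  congr 1
  rw [natCast_eq_ite_odd (L.count e)]
  by_cases h : Even (L.count e)
  · rw [if_pos h, if_neg (Nat.not_odd_iff_even.2 h)]; rfl
  · rw [if_neg h, if_pos (Nat.not_even_iff_odd.1 h), Nat.cast_one]

/-- The constraints of `P(2G, T)` force a connected-`T`-join of at most `3/2` times the value. -/
theorem exists_isConnectedTJoin_of_mem_polyP (hl : G.Loopless) (hV : V(G).Finite)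
    (hE : E(G).Finite) (hne : V(G).Nonempty) {T : Set α} (hT : T ⊆ V(G)) (he : Even T.ncard)
    {x : E(G.double) → ℝ} (hx : x ∈ G.double.polyP T) :
    ∃ F, G.IsConnectedTJoin T F ∧ 2 * (F.ncard : ℝ) ≤ 3 * ∑ᶠ e, x e := by
  classical
  have := (finite_edgeSet_double hE).fintype
  have hloop : ∀ e : E(G.double), G.double.src e ≠ G.double.tgt e := fun e =>
    IsLink.ne (G := G) (double_isLink.1 (isLink_src_tgt e))
  have hV' : V(G.double).Finite := hV
  obtain ⟨L, hL, hsp, hc⟩ := EdgeEnds.exists_spanning_join hloop hx.1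
    ((Set.Finite.toFinset_nonempty hV').2 hne) (evenOn_parity hV' hT he)
    (cutBound_of_mem_polyP hV' hx) (partitionBound_of_mem_polyP hV' hx)
  rw [edgesIn_eq_univ, ← finsum_eq_sum_of_fintype] at hc
  -- The two copies of an edge are identified before reducing, so that the total multiplicity of an
  -- edge of `G`, whose parity matters, is what gets distributed over its copies.
  let L' : Multiset β := L.map fun e : E(G.double) => (e : β × Bool).1
  have hmem : ∀ p ∈ reduceCopies L', p ∈ E(G.double) := by
    intro p hp
    have h := (Finset.mem_product.1 (Finset.mem_filter.1 hp).1).1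
    rw [Multiset.mem_toFinset, Multiset.mem_map] at h
    obtain ⟨e, -, h⟩ := h
    rw [mem_edgeSet_double, ← h]
    exact e.2
  refine ⟨reduceCopies L', ⟨⟨hmem, ?_⟩, hne, ?_⟩, ?_⟩
  · ext v
    have h1 : ((G.double.cut {v} ∩ (reduceCopies L' : Set (β × Bool))).ncard : ZMod 2) =
        parity T v := by
      rw [← hL.boundary_eq, boundary_apply, ncard_inter_eq_sum (Finset.finite_toSet _),
        Finset.finite_toSet_toFinset, Nat.cast_sum]
      have := sum_reduceCopies_zmod L' fun e => parity (G.cut {v}) e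
      rw [Multiset.map_map] at this
      refine Eq.trans (Finset.sum_congr rfl fun p _ => ?_) this
      rw [parity, double_mem_cut]
      split_ifs <;> simp
    rw [natCast_eq_ite_odd, parity] at h1
    constructor
    · intro hv
      refine ⟨hT hv, ?_⟩
      by_contra hodd
      rw [if_neg hodd, if_pos hv] at h1
      exact zero_ne_one h1
    · rintro ⟨-, hodd⟩
      by_contra hv
      rw [if_pos hodd, if_neg hv] at h1
      exact one_ne_zero h1
  · intro u hu v hv
    let r : Setoid α :=
      ⟨Relation.ReflTransGen (G.double.restrict (reduceCopies L')).Adj, fun _ => .refl,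
        fun h => Relation.ReflTransGen.stdSymm.symm _ _ h, fun h h' => h.trans h'⟩
    have hle : EdgeEnds.linked G.double.src G.double.tgt L ≤ r := by
      refine EdgeEnds.linked_le fun e he => Relation.ReflTransGen.single ⟨(e.1.1, false), ?_, ?_⟩
      · refine Finset.mem_filter.2 ⟨Finset.mem_product.2 ⟨?_, Finset.mem_univ _⟩, Or.inl rfl⟩
        exact Multiset.mem_toFinset.2 (Multiset.mem_map.2 ⟨e, he, rfl⟩)
      · exact double_isLink.1 (isLink_src_tgt e)
    exact hle (hsp u (hV'.mem_toFinset.2 hu) v (hV'.mem_toFinset.2 hv))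
  · have h1 : (reduceCopies L').card ≤ L.card :=
      (card_reduceCopies_le L').trans (Multiset.card_map _ _).le
    have h2 : ((reduceCopies L').card : ℝ) ≤ L.card := by exact_mod_cast h1
    rw [Set.ncard_coe_finset]
    linarith

end Graph

/-! ### Integer points, feasible vectors and compactness -/

namespace Graph

variable {α : Type u} {β : Type v} {G : Graph α β}

theorem edgeSum_le_finsum [Finite E(G)] {x : E(G) → ℝ} (hx : ∀ e, 0 ≤ x e) (S : Set β) :
    G.edgeSum x S ≤ ∑ᶠ e, x e := by
  classical
  have := Fintype.ofFinite E(G)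
  rw [edgeSum_eq_sum, finsum_eq_sum_of_fintype]
  exact Finset.sum_le_sum fun e _ => by split_ifs; exacts [le_rfl, hx e]

theorem edgeSum_const (hE : E(G).Finite) (c : ℝ) {S : Set β} (hS : S ⊆ E(G)) :
    G.edgeSum (fun _ => c) S = c * S.ncard := by
  classical
  have := hE.fintype
  have h := edgeSum_incidenceVector (G := G) hE subset_rfl S
  rw [Set.inter_eq_left.2 hS, edgeSum_eq_sum] at h
  rw [← h, edgeSum_eq_sum, Finset.mul_sum]
  refine Finset.sum_congr rfl fun e _ => ?_
  split_ifs <;> simp [incidenceVector]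

theorem continuous_edgeSum [Finite E(G)] (S : Set β) : Continuous fun x => G.edgeSum x S := by
  classical
  have := Fintype.ofFinite E(G)
  simp only [edgeSum_eq_sum]
  refine continuous_finsetSum _ fun e _ => ?_
  split_ifs
  · exact continuous_apply e
  · exact continuous_const

theorem Connected.cut_inter_nonempty {F : Set β} (h : (G.restrict F).Connected) {W : Set α}
    (hne : W.Nonempty) (hW : W ⊂ V(G)) : (G.cut W ∩ F).Nonempty := by
  obtain ⟨w, hw⟩ := hne
  obtain ⟨v, hv, hvW⟩ := Set.exists_of_ssubset hW
  by_contra hcon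
  refine hvW ?_
  have hr := h.2 w (hW.1 hw) v hv
  clear hv hvW
  induction hr with
  | refl => exact hw
  | tail _ hbc ih =>
    obtain ⟨e, he, hl⟩ := hbc
    by_contra hc
    exact hcon ⟨e, ⟨_, _, hl, ih, hc⟩, he⟩

/-- The vertices reachable from `u` and the remaining ones would form a partition into two classes
without an edge of `F` between them. -/
theorem restrict_connected_of_polyP (hE : E(G).Finite) {F : Set β} (hF : F ⊆ E(G)) {T : Set α}
    (hne : V(G).Nonempty) (hx : G.incidenceVector F ∈ G.polyP T) : (G.restrict F).Connected := by
  classical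
  refine ⟨hne, fun u hu v hv => ?_⟩
  by_contra hcon
  have huv : u ≠ v := fun h => hcon (h ▸ .refl)
  let f : α → α := fun w => if Relation.ReflTransGen (G.restrict F).Adj u w then u else v
  have hf : f '' V(G) = {u, v} := by
    ext w
    constructor
    · rintro ⟨z, -, rfl⟩
      simp only [f]
      split_ifs <;> simp
    · rintro (rfl | rfl)
      · exact ⟨w, hu, if_pos .refl⟩
      · exact ⟨w, hv, if_neg hcon⟩
  have h := hx.2.2 (colourPartition V(G) f)
  rw [ncard_colourPartition, hf, Set.ncard_pair huv, edgeSum_incidenceVector hE hF] at h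
  have hpos : 0 < (G.partitionCut (colourPartition V(G) f) ∩ F).ncard := by
    rw [← Nat.cast_pos (α := ℝ)]
    push_cast at h
    linarith
  obtain ⟨e, heC, heF⟩ := Set.nonempty_of_ncard_ne_zero hpos.ne'
  obtain ⟨x, y, hl⟩ := G.exists_isLink_of_mem_edgeSet (hF heF)
  refine (hl.mem_partitionCut_colourPartition f).1 heC ?_
  have hadj : (G.restrict F).Adj x y := ⟨e, heF, hl⟩
  have : Relation.ReflTransGen (G.restrict F).Adj u x ↔
      Relation.ReflTransGen (G.restrict F).Adj u y :=
    ⟨fun h => h.tail hadj, fun h => h.tail hadj.symm⟩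
  simp only [f, this]

/-- For `W = {v}` and the edge set `δ(v) ∩ F` the left side of the inequality is 0, so its parity
condition cannot hold. -/
theorem isTJoin_of_polyQ (hE : E(G).Finite) {F : Set β} (hF : F ⊆ E(G)) {T : Set α}
    (hT : T ⊆ V(G)) (hx : G.incidenceVector F ∈ G.polyQ T) : G.IsTJoin T F := by
  classical
  refine ⟨hF, ?_⟩
  have key : ∀ v ∈ V(G), ¬ Odd (({v} ∩ T : Set α).ncard + (G.cut {v} ∩ F).ncard) := by
    intro v hv hodd
    have h := hx.2 {v} (Set.singleton_subset_iff.2 hv) (G.cut {v} ∩ F) Set.inter_subset_left hodd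
    rw [edgeSum_incidenceVector hE hF, edgeSum_incidenceVector hE hF, Set.inter_assoc,
      Set.inter_self, sub_self, zero_add] at h
    have h0 : (G.cut {v} \ (G.cut {v} ∩ F)) ∩ F = ∅ := by
      ext e; simp
    rw [h0, Set.ncard_empty, Nat.cast_zero] at h
    linarith
  ext v
  constructor
  · intro hv
    refine ⟨hT hv, ?_⟩
    have h := key v (hT hv)
    rw [Set.inter_eq_left.2 (Set.singleton_subset_iff.2 hv), Set.ncard_singleton] at h
    rw [Nat.odd_add, not_iff] at h
    by_contra hc
    rw [Nat.not_odd_iff_even] at hc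
    exact (h.2 hc) odd_one
  · rintro ⟨hv, hodd⟩
    by_contra hvT
    have h := key v hv
    rw [Set.singleton_inter_eq_empty.2 hvT, Set.ncard_empty, zero_add] at h
    exact h hodd

theorem exists_incidenceVector_eq {T : Set α} {x : E(G) → ℝ} (hx : x ∈ G.polyQ T)
    (hint : ∀ e, ∃ k : ℤ, x e = k) : ∃ F ⊆ E(G), G.incidenceVector F = x := by
  classical
  refine ⟨{e | ∃ h : e ∈ E(G), x ⟨e, h⟩ = 1}, fun e ⟨h, _⟩ => h, ?_⟩
  ext e
  have h01 : x e = 0 ∨ x e = 1 := by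
    obtain ⟨k, hk⟩ := hint e
    obtain ⟨h0, h1⟩ := hx.1 e
    rw [hk] at h0 h1
    have h0' : 0 ≤ k := by exact_mod_cast h0
    have h1' : k ≤ 1 := by exact_mod_cast h1
    obtain rfl | rfl : k = 0 ∨ k = 1 := by omega
    · left; simpa using hk
    · right; simpa using hk
  rcases h01 with h | h
  · rw [h, incidenceVector, Set.indicator_of_notMem]
    rintro ⟨_, h'⟩
    rw [h] at h'
    exact zero_ne_one h'
  · rw [h, incidenceVector, Set.indicator_of_mem]
    · rfl
    · exact ⟨e.2, h⟩

theorem incidenceVector_mem_Icc (F : Set β) (e : E(G)) :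
    0 ≤ G.incidenceVector F e ∧ G.incidenceVector F e ≤ 1 := by
  classical
  simp only [incidenceVector, Set.indicator_apply, Pi.one_apply]
  split_ifs <;> norm_num

theorem IsTJoin.incidenceVector_mem_polyP (hV : V(G).Finite) (hE : E(G).Finite) {T : Set α}
    {F : Set β} (hF : G.IsTJoin T F) (hconn : (G.restrict F).Connected) :
    G.incidenceVector F ∈ G.polyP T := by
  refine ⟨fun e => (incidenceVector_mem_Icc F e).1, fun W hne hW heven => ?_, fun 𝒲 => ?_⟩
  · rw [edgeSum_incidenceVector hE hF.1]
    have hWfin : W.Finite := hV.subset hW.1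
    have h := hF.natCast_ncard_cut_inter (hE.subset hF.1) (W := hWfin.toFinset)
      (by rw [hWfin.coe_toFinset]; exact hW.1)
    rw [hWfin.coe_toFinset, (ZMod.natCast_eq_zero_iff_even).2 heven,
      ZMod.natCast_eq_zero_iff_even] at h
    have hpos := (Set.ncard_pos (hE.subset (Set.inter_subset_right.trans hF.1))).2
      (hconn.cut_inter_nonempty hne hW)
    have h2 : 2 ≤ (G.cut W ∩ F).ncard := by
      obtain ⟨k, hk⟩ := h
      omega
    exact_mod_cast h2
  · rw [edgeSum_incidenceVector hE hF.1]
    have h := ncard_partition_le (hE.subset hF.1) hV hconn 𝒲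
    have h' : ((𝒲 : Set (Set α)).ncard : ℝ) ≤ (G.partitionCut 𝒲 ∩ F).ncard + 1 := by
      exact_mod_cast h
    linarith

/-- The left side is the size of the symmetric difference of `F'` and `δ(W) ∩ F`. It could only
vanish for `F' = δ(W) ∩ F`, which has the parity of `|W ∩ T|`. -/
theorem IsTJoin.incidenceVector_mem_polyQ (hV : V(G).Finite) (hE : E(G).Finite) {T : Set α}
    {F : Set β} (hF : G.IsTJoin T F) : G.incidenceVector F ∈ G.polyQ T := by
  refine ⟨incidenceVector_mem_Icc F, fun W hW F' hF' hodd => ?_⟩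
  rw [edgeSum_incidenceVector hE hF.1, edgeSum_incidenceVector hE hF.1]
  have hfin' : F'.Finite := hE.subset (hF'.trans (cut_subset_edgeSet W))
  have h1 := Set.ncard_inter_le_ncard_left F' F hfin'
  suffices h : (F' ∩ F).ncard + 1 ≤ F'.ncard + ((G.cut W \ F') ∩ F).ncard by
    have h' : (((F' ∩ F).ncard : ℝ) + 1) ≤ F'.ncard + ((G.cut W \ F') ∩ F).ncard := by
      exact_mod_cast h
    linarith
  by_contra hcon
  have h2 : F'.ncard ≤ (F' ∩ F).ncard := by omega
  have h3 : ((G.cut W \ F') ∩ F).ncard = 0 := by omega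
  have h4 : F' ∩ F = F' := Set.eq_of_subset_of_ncard_le Set.inter_subset_left h2 hfin'
  rw [Set.ncard_eq_zero (hE.subset (Set.inter_subset_right.trans hF.1))] at h3
  have h5 : G.cut W ∩ F = F' := by
    ext e
    constructor
    · intro he
      by_contra heF
      exact (Set.eq_empty_iff_forall_notMem.1 h3 e) ⟨⟨he.1, heF⟩, he.2⟩
    · intro he
      exact ⟨hF' he, (h4.symm ▸ he : e ∈ F' ∩ F).2⟩
  have hWfin : W.Finite := hV.subset hW
  have h := hF.natCast_ncard_cut_inter (hE.subset hF.1) (W := hWfin.toFinset)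
    (by rw [hWfin.coe_toFinset]; exact hW)
  rw [hWfin.coe_toFinset, h5] at h
  have h6 : (((W ∩ T).ncard + F'.ncard : ℕ) : ZMod 2) = 0 := by
    rw [Nat.cast_add, h, CharTwo.add_self_eq_zero]
  rw [ZMod.natCast_eq_zero_iff_even] at h6
  exact Nat.not_even_iff_odd.2 hodd h6

/-- The integer points of `P ∩ Q` are the incidence vectors of the connected-`T`-joins. -/
theorem integerPoints_polyP_inter_polyQ (hV : V(G).Finite) (hE : E(G).Finite)
    (hne : V(G).Nonempty) {T : Set α} (hT : T ⊆ V(G)) :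
    integerPoints (G.double.polyP T ∩ G.double.polyQ T) =
      G.double.incidenceVector '' {F | G.IsConnectedTJoin T F} := by
  have hE' := finite_edgeSet_double hE
  have hV' : V(G.double).Finite := hV
  ext x
  constructor
  · rintro ⟨⟨hP, hQ⟩, hint⟩
    obtain ⟨F, hF, rfl⟩ := exists_incidenceVector_eq hQ hint
    exact ⟨F, ⟨isTJoin_of_polyQ hE' hF hT hQ, restrict_connected_of_polyP hE' hF hne hP⟩, rfl⟩
  · rintro ⟨F, ⟨hF, hconn⟩, rfl⟩
    refine ⟨⟨hF.incidenceVector_mem_polyP hV' hE' hconn, hF.incidenceVector_mem_polyQ hV' hE'⟩,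
      fun e => ?_⟩
    classical
    by_cases h : (e : β × Bool) ∈ F
    · exact ⟨1, by simp [incidenceVector, h]⟩
    · exact ⟨0, by simp [incidenceVector, h]⟩

theorem cut_double (W : Set α) : G.double.cut W = G.cut W ×ˢ Set.univ := by
  ext p; simp [double_mem_cut]

theorem partitionCut_double (𝒲 : Partition V(G)) :
    G.double.partitionCut 𝒲 = G.partitionCut 𝒲 ×ˢ Set.univ := by
  ext p
  simp only [partitionCut, cut_double, Set.mem_iUnion, Set.mem_prod, Set.mem_univ, and_true,
    exists_prop]
  rfl

/-- Connectedness gives at least `|𝒲| - 1` edges of `G` between the classes, and doubling makes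
weight `1/2` sufficient. The lemma is used with `c = 1` for feasibility and `c = 1/2` for cycles. -/
theorem const_mem_polyP_double (hV : V(G).Finite) (hE : E(G).Finite) (hG : G.Connected) {c : ℝ}
    (hc : 1 / 2 ≤ c) (hcut : ∀ W : Set α, W.Nonempty → W ⊂ V(G) → 1 ≤ c * (G.cut W).ncard)
    (T : Set α) : (fun _ => c) ∈ G.double.polyP T := by
  have hE' := finite_edgeSet_double hE
  refine ⟨fun _ => by linarith, fun W hne hW _ => ?_, fun 𝒲 => ?_⟩
  · rw [edgeSum_const hE' c (cut_subset_edgeSet W), cut_double, Set.ncard_prod, Set.ncard_univ]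
    have := hcut W hne hW
    simp only [Nat.card_eq_fintype_card, Fintype.card_bool]
    push_cast
    linarith
  · have key : ∀ 𝒲 : Partition V(G),
        ((𝒲 : Set (Set α)).ncard : ℝ) - 1 ≤ c * ((G.partitionCut 𝒲).ncard * 2) := by
      intro 𝒲
      have h := ncard_partition_le (G := G) (F := E(G)) hE hV (by rwa [restrict_self]) 𝒲
      rw [Set.inter_eq_left.2 (partitionCut_subset_edgeSet _)] at h
      have h' : ((𝒲 : Set (Set α)).ncard : ℝ) ≤ (G.partitionCut 𝒲).ncard + 1 := by
        exact_mod_cast h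
      have h0 : (0 : ℝ) ≤ (G.partitionCut 𝒲).ncard := Nat.cast_nonneg _
      nlinarith
    have hcard : (G.double.partitionCut 𝒲).ncard = (G.partitionCut 𝒲).ncard * 2 := by
      refine (congrArg Set.ncard (partitionCut_double (G := G) 𝒲)).trans ?_
      rw [Set.ncard_prod, Set.ncard_univ, Nat.card_eq_fintype_card, Fintype.card_bool]
    rw [edgeSum_const hE' c (partitionCut_subset_edgeSet _), hcard, Nat.cast_mul]
    exact key 𝒲

theorem Connected.cut_nonempty (hG : G.Connected) {W : Set α} (hne : W.Nonempty) (hW : W ⊂ V(G)) :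
    (G.cut W).Nonempty := by
  have h : (G.restrict E(G)).Connected := by rwa [restrict_self]
  exact (h.cut_inter_nonempty hne hW).mono Set.inter_subset_left

/-- The all-ones vector lies in `P(2G, T)`, so the rounding bound already provides a
connected-`T`-join. -/
theorem exists_isConnectedTJoin (hl : G.Loopless) (hV : V(G).Finite) (hE : E(G).Finite)
    (hG : G.Connected) {T : Set α} (hT : T ⊆ V(G)) (he : Even T.ncard) :
    ∃ F, G.IsConnectedTJoin T F := by
  have h : (fun _ => (1 : ℝ)) ∈ G.double.polyP T := by
    refine const_mem_polyP_double hV hE hG (by norm_num) (fun W hne hW => ?_) T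
    have hpos := (Set.ncard_pos (hE.subset (cut_subset_edgeSet W))).2 (hG.cut_nonempty hne hW)
    rw [one_mul]
    exact_mod_cast hpos
  obtain ⟨F, hF, -⟩ := exists_isConnectedTJoin_of_mem_polyP hl hV hE hG.1 hT he h
  exact ⟨F, hF⟩

theorem isClosed_polyP [Finite E(G)] (T : Set α) : IsClosed (G.polyP T) := by
  simp only [polyP, Set.ofPred_and, Set.ofPred_forall]
  refine IsClosed.inter (isClosed_iInter fun e => ?_) (IsClosed.inter ?_ ?_)
  · exact isClosed_le continuous_const (continuous_apply e)
  · refine isClosed_iInter fun W => isClosed_iInter fun _ => isClosed_iInter fun _ =>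
      isClosed_iInter fun _ => ?_
    exact isClosed_le continuous_const (continuous_edgeSum _)
  · exact isClosed_iInter fun 𝒲 => isClosed_le continuous_const (continuous_edgeSum _)

theorem isCompact_polyQ [Finite E(G)] (T : Set α) : IsCompact (G.polyQ T) := by
  have hI : IsCompact (Set.univ.pi fun _ : E(G) => Set.Icc (0 : ℝ) 1) :=
    isCompact_univ_pi fun _ => isCompact_Icc
  refine hI.of_isClosed_subset ?_ fun x hx e _ => hx.1 e
  simp only [polyQ, Set.ofPred_and, Set.ofPred_forall]
  refine IsClosed.inter (isClosed_iInter fun e => IsClosed.inter ?_ ?_) ?_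
  · exact isClosed_le continuous_const (continuous_apply e)
  · exact isClosed_le (continuous_apply e) continuous_const
  · refine isClosed_iInter fun W => isClosed_iInter fun _ => isClosed_iInter fun F =>
      isClosed_iInter fun _ => isClosed_iInter fun _ => ?_
    exact isClosed_le continuous_const
      ((continuous_const.sub (continuous_edgeSum _)).add (continuous_edgeSum _))

theorem one_le_finsum_of_mem_polyP [Finite E(G)] (hV : V(G).Finite) (hn : V(G).Nontrivial)
    {T : Set α} {x : E(G) → ℝ} (hx : x ∈ G.polyP T) : 1 ≤ ∑ᶠ e, x e := by
  have h := hx.2.2 (colourPartition V(G) id)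
  rw [ncard_colourPartition, Set.image_id] at h
  have := hV.to_subtype
  have h2 : 1 < V(G).ncard := Set.one_lt_ncard_iff_nontrivial.2 hn
  have h2' : (2 : ℝ) ≤ V(G).ncard := by exact_mod_cast h2
  have h3 := edgeSum_le_finsum hx.1 (G.partitionCut (colourPartition V(G) id))
  linarith

end Graph

/-! ### Existence of the minima and the upper bound on the ratio -/

namespace ConnTInstance

variable (I : ConnTInstance.{u, v})

theorem integerPoints_eq :
    integerPoints (I.G.double.polyP I.T ∩ I.G.double.polyQ I.T) =
      I.G.double.incidenceVector '' {F | I.G.IsConnectedTJoin I.T F} :=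
  Graph.integerPoints_polyP_inter_polyQ I.finite_vertexSet I.finite_edgeSet I.connected.1 I.subset

theorem integerPoints_nonempty :
    (integerPoints (I.G.double.polyP I.T ∩ I.G.double.polyQ I.T)).Nonempty := by
  rw [integerPoints_eq]
  obtain ⟨F, hF⟩ := Graph.exists_isConnectedTJoin I.loopless I.finite_vertexSet I.finite_edgeSet
    I.connected I.subset I.even
  exact ⟨_, F, hF, rfl⟩

theorem exists_isUnitMin_integerPoints :
    ∃ a, IsUnitMin (integerPoints (I.G.double.polyP I.T ∩ I.G.double.polyQ I.T)) a := by
  have hfin : (integerPoints (I.G.double.polyP I.T ∩ I.G.double.polyQ I.T)).Finite := by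
    rw [integerPoints_eq]
    refine Set.Finite.image _ ((Graph.finite_edgeSet_double I.finite_edgeSet).finite_subsets.subset
      fun F hF => hF.1.1)
  obtain ⟨x, hx, hmin⟩ := Set.exists_min_image _ (fun x => ∑ᶠ e, x e) hfin I.integerPoints_nonempty
  exact ⟨_, ⟨x, hx, rfl⟩, by rintro _ ⟨y, hy, rfl⟩; exact hmin y hy⟩

theorem exists_isUnitMin : ∃ b, IsUnitMin (I.G.double.polyP I.T ∩ I.G.double.polyQ I.T) b := by
  have hcomp : IsCompact (I.G.double.polyP I.T ∩ I.G.double.polyQ I.T) :=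
    (Graph.isCompact_polyQ I.T).inter_left (Graph.isClosed_polyP I.T)
  have hcont : Continuous fun x : E(I.G.double) → ℝ => ∑ᶠ e, x e := by
    simp only [Graph.finsum_eq_edgeSum]
    exact Graph.continuous_edgeSum _
  obtain ⟨x, hx, hmin⟩ := hcomp.exists_isMinOn
    (I.integerPoints_nonempty.mono fun x hx => hx.1) hcont.continuousOn
  exact ⟨_, ⟨x, hx, rfl⟩, by rintro _ ⟨y, hy, rfl⟩; exact hmin hy⟩

theorem one_le_of_isUnitMin {b : ℝ}
    (hb : IsUnitMin (I.G.double.polyP I.T ∩ I.G.double.polyQ I.T) b) : 1 ≤ b := by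
  obtain ⟨⟨x, hx, rfl⟩, -⟩ := hb
  exact Graph.one_le_finsum_of_mem_polyP (G := I.G.double) I.finite_vertexSet I.nontrivial hx.1

theorem div_le_of_isUnitMin {a b : ℝ}
    (ha : IsUnitMin (integerPoints (I.G.double.polyP I.T ∩ I.G.double.polyQ I.T)) a)
    (hb : IsUnitMin (I.G.double.polyP I.T ∩ I.G.double.polyQ I.T) b) : a / b ≤ 3 / 2 := by
  have hb1 := I.one_le_of_isUnitMin hb
  obtain ⟨⟨x, hx, rfl⟩, -⟩ := hb
  obtain ⟨F, hF, hle⟩ := Graph.exists_isConnectedTJoin_of_mem_polyP I.loopless I.finite_vertexSet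
    I.finite_edgeSet I.connected.1 I.subset I.even hx.1
  have hmem : I.G.double.incidenceVector F ∈
      integerPoints (I.G.double.polyP I.T ∩ I.G.double.polyQ I.T) := by
    rw [integerPoints_eq]
    exact ⟨F, hF, rfl⟩
  have h := ha.2 ⟨_, hmem, rfl⟩
  simp only [Graph.finsum_incidenceVector (Graph.finite_edgeSet_double I.finite_edgeSet) hF.1.1]
    at h
  simp only at hb1
  rw [div_le_iff₀ (by linarith)]
  linarith

end ConnTInstance

/-! ### Cycles with opposite terminals -/

namespace Graph

variable {α : Type u} {β : Type v} {G : Graph α β}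

/-- At the constant `1/2` the left side is half the cut size in `2G`, that is `|δ(W)|` in `G`,
whatever `F` is. The cut is empty only for `W = ∅` or `W = V(G)`, where evenness of `|T|`
contradicts the parity condition. -/
theorem half_mem_polyQ_double (hE : E(G).Finite) (hG : G.Connected) {T : Set α} (hT : T ⊆ V(G))
    (he : Even T.ncard) : (fun _ => (1 / 2 : ℝ)) ∈ G.double.polyQ T := by
  have hE' := finite_edgeSet_double hE
  refine ⟨fun _ => by norm_num, fun W hW F hF hodd => ?_⟩
  have hcutE := cut_subset_edgeSet (G := G.double) W
  rw [edgeSum_const hE' _ (hF.trans hcutE), edgeSum_const hE' _ (Set.sdiff_subset.trans hcutE)]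
  have hcard : ((G.double.cut W).ncard : ℝ) = (G.double.cut W \ F).ncard + F.ncard := by
    exact_mod_cast (Set.ncard_sdiff_add_ncard_of_subset hF (hE'.subset hcutE)).symm
  suffices h : 1 ≤ (G.cut W).ncard by
    have h2 : (G.double.cut W).ncard = (G.cut W).ncard * 2 := by
      rw [cut_double, Set.ncard_prod, Set.ncard_univ, Nat.card_eq_fintype_card, Fintype.card_bool]
    rw [h2] at hcard
    have h' : (1 : ℝ) ≤ (G.cut W).ncard := by exact_mod_cast h
    push_cast at hcard
    linarith
  refine (Set.ncard_pos (hE.subset (cut_subset_edgeSet W))).2 ?_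
  by_contra hemp
  have hF0 : F = ∅ := by
    refine Set.eq_empty_iff_forall_notMem.2 fun p hp => hemp ⟨p.1, double_mem_cut.1 (hF hp)⟩
  rw [hF0, Set.ncard_empty, add_zero] at hodd
  by_cases hne : W.Nonempty
  · by_cases hWV : W = V(G)
    · rw [hWV, Set.inter_eq_right.2 hT] at hodd
      exact Nat.not_even_iff_odd.2 hodd he
    · exact hemp (hG.cut_nonempty hne (hW.ssubset_of_ne hWV))
  · rw [Set.not_nonempty_iff_eq_empty.1 hne] at hodd
    simp at hodd

theorem ncard_edgeSet_double : E(G.double).ncard = E(G).ncard * 2 := by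
  have : E(G.double) = E(G) ×ˢ Set.univ := by
    ext p; simp [mem_edgeSet_double]
  rw [this, Set.ncard_prod, Set.ncard_univ, Nat.card_eq_fintype_card, Fintype.card_bool]

/-- The cycle with the vertices `0, …, n - 1`. -/
def cycle (n : ℕ) : Graph (ULift.{u} ℕ) (ULift.{v} ℕ) where
  vertexSet := {x | x.down < n}
  edgeSet := {e | e.down < n}
  IsLink e x y := e.down < n ∧ ((x.down = e.down ∧ y.down = (e.down + 1) % n) ∨
    (y.down = e.down ∧ x.down = (e.down + 1) % n))
  isLink_symm _ _ := ⟨fun _ _ h => ⟨h.1, h.2.symm⟩⟩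
  eq_or_eq_of_isLink_of_isLink e x y z w h h' := by
    simp only [ULift.ext_iff]
    omega
  edge_mem_iff_exists_isLink e := by
    refine ⟨fun h => ⟨⟨e.down⟩, ⟨(e.down + 1) % n⟩, h, Or.inl ⟨rfl, rfl⟩⟩, fun ⟨_, _, h⟩ => h.1⟩
  left_mem_of_isLink e x y h := by
    have := Nat.mod_lt (e.down + 1) (show 0 < n by have := h.1; omega)
    have h1 := h.1
    show x.down < n
    omega

variable {n : ℕ}

theorem cycle_isLink {i : ℕ} (hi : i < n) :
    (cycle.{u, v} n).IsLink ⟨i⟩ ⟨i⟩ ⟨(i + 1) % n⟩ := ⟨hi, Or.inl ⟨rfl, rfl⟩⟩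

theorem finite_vertexSet_cycle : V(cycle.{u, v} n).Finite :=
  ((Set.finite_lt_nat n).image ULift.up).subset fun x hx => ⟨x.down, hx, rfl⟩

theorem finite_edgeSet_cycle : E(cycle.{u, v} n).Finite :=
  ((Set.finite_lt_nat n).image ULift.up).subset fun x hx => ⟨x.down, hx, rfl⟩

theorem ncard_edgeSet_cycle : E(cycle.{u, v} n).ncard = n := by
  have : E(cycle.{u, v} n) = ULift.up '' {i | i < n} := by
    ext e; exact ⟨fun h => ⟨e.down, h, rfl⟩, fun ⟨i, h, hi⟩ => hi ▸ h⟩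
  rw [this, Set.ncard_image_of_injective _ ULift.up_injective]
  have h2 : {i | i < n} = ((Finset.range n : Finset ℕ) : Set ℕ) := by ext; simp
  rw [h2, Set.ncard_coe_finset, Finset.card_range]

theorem cycle_loopless (hn : 2 ≤ n) : (cycle.{u, v} n).Loopless := by
  rw [loopless_iff_forall_ne_of_adj]
  rintro x y ⟨e, he, h⟩ rfl
  have h1 : (e.down + 1) % n ≠ e.down := by
    by_cases hlt : e.down + 1 < n
    · rw [Nat.mod_eq_of_lt hlt]; omega
    · rw [show e.down + 1 = n by omega, Nat.mod_self]; omega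
  omega

theorem cycle_connected (hn : 0 < n) : (cycle.{u, v} n).Connected := by
  have h0 : ∀ i < n, Relation.ReflTransGen (cycle.{u, v} n).Adj ⟨0⟩ ⟨i⟩ := by
    intro i hi
    induction i with
    | zero => exact .refl
    | succ i ih =>
      refine (ih (by omega)).tail ⟨⟨i⟩, ?_⟩
      have := cycle_isLink.{u, v} (show i < n by omega)
      rwa [Nat.mod_eq_of_lt hi] at this
  refine ⟨⟨⟨0⟩, hn⟩, fun x hx y hy => ?_⟩
  exact (Relation.ReflTransGen.stdSymm.symm _ _ (h0 x.down hx)).trans (h0 y.down hy)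

theorem cycle_even_ncard_cut (W : Set (ULift.{u} ℕ)) : Even ((cycle.{u, v} n).cut W).ncard := by
  classical
  let p : ℕ → ZMod 2 := fun i => if (⟨i⟩ : ULift.{u} ℕ) ∈ W then 1 else 0
  have h1 : (cycle.{u, v} n).cut W = ULift.up ''
      (((Finset.range n).filter fun i => (⟨i⟩ : ULift.{v} ℕ) ∈ (cycle.{u, v} n).cut W : Finset ℕ) :
        Set ℕ) := by
    ext e
    constructor
    · intro he
      have hlt : e.down < n := cut_subset_edgeSet W he
      exact ⟨e.down, by simpa [hlt] using he, rfl⟩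
    · rintro ⟨i, hi, rfl⟩
      exact (Finset.mem_filter.1 hi).2
  rw [← ZMod.natCast_eq_zero_iff_even, h1, Set.ncard_image_of_injective _ ULift.up_injective,
    Set.ncard_coe_finset, Finset.card_filter, Nat.cast_sum]
  have h2 : ∀ i ∈ Finset.range n,
      ((if (⟨i⟩ : ULift.{v} ℕ) ∈ (cycle.{u, v} n).cut W then 1 else 0 : ℕ) : ZMod 2) =
        p i + p ((i + 1) % n) := by
    intro i hi
    rw [(cycle_isLink.{u, v} (Finset.mem_range.1 hi)).mem_cut_iff]
    simp only [p]
    by_cases ha : (⟨i⟩ : ULift.{u} ℕ) ∈ W <;>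
      by_cases hb : (⟨(i + 1) % n⟩ : ULift.{u} ℕ) ∈ W <;>
      simp [ha, hb, CharTwo.add_self_eq_zero]
  rw [Finset.sum_congr rfl h2, Finset.sum_add_distrib]
  have h3 : ∑ i ∈ Finset.range n, p ((i + 1) % n) = ∑ i ∈ Finset.range n, p i := by
    cases n with
    | zero => rfl
    | succ m =>
      rw [Finset.sum_range_succ, Nat.mod_self, Finset.sum_range_succ']
      congr 1
      refine Finset.sum_congr rfl fun i hi => ?_
      rw [Nat.mod_eq_of_lt (by have := Finset.mem_range.1 hi; omega)]
  rw [h3, CharTwo.add_self_eq_zero]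

theorem cycle_half_mem_polyP (hn : 0 < n) (T : Set (ULift.{u} ℕ)) :
    (fun _ => (1 / 2 : ℝ)) ∈ (cycle.{u, v} n).double.polyP T := by
  refine const_mem_polyP_double finite_vertexSet_cycle finite_edgeSet_cycle (cycle_connected hn)
    le_rfl (fun W hne hW => ?_) T
  have h1 := (Set.ncard_pos (finite_edgeSet_cycle.subset (cut_subset_edgeSet W))).2
    ((cycle_connected.{u, v} hn).cut_nonempty hne hW)
  have h2 : 2 ≤ ((cycle.{u, v} n).cut W).ncard := by
    obtain ⟨m, hm⟩ := cycle_even_ncard_cut.{u, v} (n := n) W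
    omega
  have h3 : (2 : ℝ) ≤ ((cycle.{u, v} n).cut W).ncard := by exact_mod_cast h2
  linarith

theorem cycle_mem_cut_arc {i j : ℕ} (hij : i < j) (hj : j < n) (e : ULift.{v} ℕ) :
    e ∈ (cycle.{u, v} n).cut {x | i < x.down ∧ x.down ≤ j} ↔ e.down = i ∨ e.down = j := by
  by_cases he : e.down < n
  · rw [(cycle_isLink.{u, v} he).mem_cut_iff (e := e)]
    simp only [Set.mem_ofPred_eq]
    by_cases hlt : e.down + 1 < n
    · rw [Nat.mod_eq_of_lt hlt]; omega
    · rw [show e.down + 1 = n by omega, Nat.mod_self]; omega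
  · refine ⟨fun h => absurd (cut_subset_edgeSet _ h) he, fun h => ?_⟩
    omega

theorem two_mul_pred_le_sum {k : ℕ} {f : ℕ → ℕ} (heven : ∀ i < k, Even (f i))
    (hpair : ∀ i j, i < j → j < k → 2 ≤ f i + f j) : 2 * k ≤ ∑ i ∈ Finset.range k, f i + 2 := by
  by_cases hz : ∃ z < k, f z = 0
  · obtain ⟨z, hz, hfz⟩ := hz
    have h1 : ∀ i ∈ (Finset.range k).erase z, 2 ≤ f i := by
      intro i hi
      obtain ⟨hne, hi⟩ := Finset.mem_erase.1 hi
      rw [Finset.mem_range] at hi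
      rcases lt_or_gt_of_ne hne with h | h
      · have := hpair i z h hz; omega
      · have := hpair z i h hi; omega
    have h2 : _ ≤ ∑ i ∈ (Finset.range k).erase z, f i := Finset.card_nsmul_le_sum _ _ _ h1
    rw [Finset.card_erase_of_mem (Finset.mem_range.2 hz), Finset.card_range, smul_eq_mul] at h2
    rw [← Finset.add_sum_erase _ _ (Finset.mem_range.2 hz)]
    omega
  · push Not at hz
    have h1 : ∀ i ∈ Finset.range k, 2 ≤ f i := by
      intro i hi
      rw [Finset.mem_range] at hi
      obtain ⟨m, hm⟩ := heven i hi
      have := hz i hi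
      omega
    have h2 : _ ≤ ∑ i ∈ Finset.range k, f i := Finset.card_nsmul_le_sum _ _ _ h1
    rw [Finset.card_range, smul_eq_mul] at h2
    omega

/-- Here `c i` is the multiplicity of the edge `i` of the cycle, and the terminals split the edges
into the halves `i < k` and `k ≤ i`. Parity is constant on each half and differs between them. The
odd half contributes at least `k`; in the even half at most one edge is missing, so it contributes
at least `2(k - 1)`. -/
theorem three_mul_le_sum {k : ℕ} (hk : 0 < k) {c : ℕ → ℕ}
    (hodd : ∀ i j, i < k → k ≤ j → j < 2 * k → Odd (c i + c j))
    (heven : ∀ i j, i < j → j < 2 * k → (j < k ∨ k ≤ i) → Even (c i + c j) ∧ 2 ≤ c i + c j) :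
    3 * k ≤ ∑ i ∈ Finset.range (2 * k), c i + 2 := by
  rw [two_mul k, Finset.sum_range_add]
  by_cases h0 : Even (c 0)
  · have hA : ∀ i < k, Even (c i) := by
      intro i hi
      rcases Nat.eq_zero_or_pos i with rfl | hpos
      · exact h0
      · exact (Nat.even_add.1 (heven 0 i hpos (by omega) (by omega)).1).1 h0
    have hB : ∀ i ∈ Finset.range k, 1 ≤ c (k + i) := by
      intro i hi
      have h := hodd 0 (k + i) hk (by omega) (by have := Finset.mem_range.1 hi; omega)
      by_contra hlt
      rw [show c (k + i) = 0 by omega, add_zero] at h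
      exact Nat.not_even_iff_odd.2 h h0
    have h1 := two_mul_pred_le_sum hA fun i j hij hj => (heven i j hij (by omega) (by omega)).2
    have h2 := Finset.card_nsmul_le_sum _ _ _ hB
    rw [Finset.card_range, smul_eq_mul] at h2
    omega
  · have hB : ∀ i < k, Even (c (k + i)) := by
      intro i hi
      have h := hodd 0 (k + i) hk (by omega) (by omega)
      rw [Nat.odd_add, ← Nat.not_even_iff_odd] at h
      exact h.1 h0
    have hA : ∀ i ∈ Finset.range k, 1 ≤ c i := by
      intro i hi
      have h := hodd i k (Finset.mem_range.1 hi) le_rfl (by omega)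
      have hk' := hB 0 hk
      by_contra hlt
      rw [show c i = 0 by omega, zero_add] at h
      exact Nat.not_even_iff_odd.2 h hk'
    have h1 := two_mul_pred_le_sum (f := fun i => c (k + i)) hB fun i j hij hj =>
      (heven (k + i) (k + j) (by omega) (by omega) (by omega)).2
    have h2 : _ ≤ ∑ i ∈ Finset.range k, c i := Finset.card_nsmul_le_sum _ _ _ hA
    rw [Finset.card_range, smul_eq_mul] at h2
    omega

/-- A connected-`{0, k}`-join of the cycle of length `2k` has at least `3k - 2` edges. -/
theorem three_mul_le_ncard_of_cycle {k : ℕ} (hk : 0 < k) {F : Set (ULift.{v} ℕ × Bool)}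
    (hF : (cycle.{u, v} (2 * k)).IsConnectedTJoin {⟨0⟩, ⟨k⟩} F) : 3 * k ≤ F.ncard + 2 := by
  classical
  have hE := finite_edgeSet_double (finite_edgeSet_cycle.{u, v} (n := 2 * k))
  have hfin : F.Finite := hE.subset hF.1.1
  let c : ℕ → ℕ := fun i => (hfin.toFinset.filter fun p => p.1.down = i).card
  have hsum : F.ncard = ∑ i ∈ Finset.range (2 * k), c i := by
    rw [Set.ncard_eq_toFinset_card F hfin]
    refine Finset.card_eq_sum_card_fiberwise fun p hp => ?_
    exact Finset.mem_coe.2 (Finset.mem_range.2 (hF.1.1 (hfin.mem_toFinset.1 hp)))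
  have hcut : ∀ i j, i < j → j < 2 * k →
      ((cycle.{u, v} (2 * k)).double.cut {x | i < x.down ∧ x.down ≤ j} ∩ F).ncard = c i + c j := by
    intro i j hij hj
    simp only [c]
    rw [ncard_inter_eq_sum hfin, ← Finset.card_filter, ← Finset.card_union_of_disjoint,
      ← Finset.filter_or]
    · congr 1
      refine Finset.filter_congr fun p _ => ?_
      rw [double_mem_cut, cycle_mem_cut_arc hij hj]
    · refine Finset.disjoint_filter.2 fun p _ h1 h2 => ?_
      omega
  -- The arc from `i + 1` to `j` never contains the terminal 0, and contains `k` exactly when `i < k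
  -- ≤ j`.
  have hpar : ∀ i j, i < j → j < 2 * k →
      ((c i + c j : ℕ) : ZMod 2) = if i < k ∧ k ≤ j then 1 else 0 := by
    intro i j hij hj
    have hWV : {x : ULift.{u} ℕ | i < x.down ∧ x.down ≤ j} ⊆
        V((cycle.{u, v} (2 * k)).double) := fun x hx => lt_of_le_of_lt hx.2 hj
    have hWfin := (finite_vertexSet_cycle.{u, v} (n := 2 * k)).subset hWV
    have h := hF.1.natCast_ncard_cut_inter hfin (W := hWfin.toFinset)
      (by rw [hWfin.coe_toFinset]; exact hWV)
    rw [hWfin.coe_toFinset, hcut i j hij hj] at h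
    rw [h]
    split_ifs with hm
    · have : {x : ULift.{u} ℕ | i < x.down ∧ x.down ≤ j} ∩ {⟨0⟩, ⟨k⟩} = {⟨k⟩} := by
        ext x
        simp only [Set.mem_inter_iff, Set.mem_ofPred_eq, Set.mem_insert_iff,
          Set.mem_singleton_iff, ULift.ext_iff]
        omega
      rw [this, Set.ncard_singleton, Nat.cast_one]
    · have : {x : ULift.{u} ℕ | i < x.down ∧ x.down ≤ j} ∩ {⟨0⟩, ⟨k⟩} = ∅ := by
        refine Set.eq_empty_iff_forall_notMem.2 ?_
        rintro x ⟨⟨h1, h2⟩, rfl | rfl⟩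
        · exact absurd h1 (Nat.not_lt_zero i)
        · exact hm ⟨h1, h2⟩
      rw [this, Set.ncard_empty, Nat.cast_zero]
  have hpos : ∀ i j, i < j → j < 2 * k → 0 < c i + c j := by
    intro i j hij hj
    rw [← hcut i j hij hj]
    refine (Set.ncard_pos (hfin.subset Set.inter_subset_right)).2
      (hF.2.cut_inter_nonempty ⟨⟨j⟩, hij, le_rfl⟩ (Set.ssubset_iff_exists.2 ⟨fun x hx => ?_, ?_⟩))
    · exact lt_of_le_of_lt hx.2 hj
    · exact ⟨⟨0⟩, show 0 < 2 * k by omega, fun h => absurd h.1 (Nat.not_lt_zero i)⟩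
  rw [hsum]
  refine three_mul_le_sum hk (fun i j hi hj hj' => ?_) fun i j hij hj hh => ?_
  · have h := hpar i j (by omega) hj'
    rw [if_pos ⟨hi, hj⟩] at h
    exact ZMod.natCast_eq_one_iff_odd.1 h
  · have h := hpar i j hij hj
    rw [if_neg (by omega), ZMod.natCast_eq_zero_iff_even] at h
    refine ⟨h, ?_⟩
    have := hpos i j hij hj
    obtain ⟨m, hm⟩ := h
    omega

end Graph

/-- The cycle of length `2k` with two opposite terminals. -/
def ConnTInstance.ofCycle (k : ℕ) (hk : 0 < k) : ConnTInstance.{u, v} where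
  α := ULift.{u} ℕ
  β := ULift.{v} ℕ
  G := Graph.cycle (2 * k)
  T := {⟨0⟩, ⟨k⟩}
  loopless := Graph.cycle_loopless (by omega)
  finite_vertexSet := Graph.finite_vertexSet_cycle
  finite_edgeSet := Graph.finite_edgeSet_cycle
  connected := Graph.cycle_connected (by omega)
  nontrivial := ⟨⟨0⟩, show 0 < 2 * k by omega, ⟨k⟩, show k < 2 * k by omega, fun h => by
    rw [ULift.ext_iff] at h
    exact hk.ne h⟩
  subset := by
    rintro x (rfl | rfl)
    · exact show 0 < 2 * k by omega
    · exact show k < 2 * k by omega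
  even := by
    rw [Set.ncard_pair]
    · exact even_two
    · intro h
      rw [ULift.ext_iff] at h
      exact hk.ne h

theorem ConnTInstance.le_div_of_ofCycle {k : ℕ} (hk : 0 < k) {a b : ℝ}
    (ha : IsUnitMin (integerPoints ((ofCycle.{u, v} k hk).G.double.polyP (ofCycle.{u, v} k hk).T ∩
      (ofCycle.{u, v} k hk).G.double.polyQ (ofCycle.{u, v} k hk).T)) a)
    (hb : IsUnitMin ((ofCycle.{u, v} k hk).G.double.polyP (ofCycle.{u, v} k hk).T ∩
      (ofCycle.{u, v} k hk).G.double.polyQ (ofCycle.{u, v} k hk).T) b) :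
    3 / 2 - 1 / (k : ℝ) ≤ a / b := by
  set I := ofCycle.{u, v} k hk 
  have hE := Graph.finite_edgeSet_double I.finite_edgeSet
  have hb1 := I.one_le_of_isUnitMin hb
  have hk' : (0 : ℝ) < k := by exact_mod_cast hk
  have ha1 : 3 * (k : ℝ) ≤ a + 2 := by
    obtain ⟨⟨x, hx, rfl⟩, -⟩ := ha
    rw [I.integerPoints_eq] at hx
    obtain ⟨F, hF, rfl⟩ := hx
    have h := Graph.three_mul_le_ncard_of_cycle hk hF
    simp only [Graph.finsum_incidenceVector hE hF.1.1]
    exact_mod_cast h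
  -- The doubled cycle has `4k` edges, each of weight `1/2`.
  have hb2 : b ≤ 2 * k := by
    have h := hb.2 ⟨fun _ => 1 / 2, ⟨Graph.cycle_half_mem_polyP (by omega) _,
      Graph.half_mem_polyQ_double I.finite_edgeSet I.connected I.subset I.even⟩, rfl⟩
    simp only [Graph.finsum_eq_edgeSum, Graph.edgeSum_const hE _ subset_rfl] at h
    have hcard : E(I.G.double).ncard = 2 * k * 2 := by
      rw [Graph.ncard_edgeSet_double]
      exact congrArg (· * 2) Graph.ncard_edgeSet_cycle
    rw [hcard] at h
    push_cast at h
    linarith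
  rw [le_div_iff₀ (by linarith)]
  have h1 : 0 ≤ 3 / 2 - 1 / (k : ℝ) ∨ 3 / 2 - 1 / (k : ℝ) < 0 := le_or_gt _ _
  have h2 : (3 / 2 - 1 / (k : ℝ)) * (2 * k) = 3 * k - 2 := by field_simp
  rcases h1 with h1 | h1
  · calc (3 / 2 - 1 / (k : ℝ)) * b ≤ (3 / 2 - 1 / (k : ℝ)) * (2 * k) := by gcongr
      _ ≤ a := by rw [h2]; linarith
  · have ha0 : 0 ≤ a := by
      have : (1 : ℝ) ≤ k := by exact_mod_cast hk
      linarith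
    nlinarith

theorem corollary32 :
    (∀ (α : Type u) (β : Type v) (G : Graph α β) (T : Set α),
      G.Loopless → V(G).Finite → E(G).Finite → G.Connected → T ⊆ V(G) → Even T.ncard →
        integerPoints (G.double.polyP T ∩ G.double.polyQ T) =
          G.double.incidenceVector '' {F | G.IsConnectedTJoin T F}) ∧
    IsUnitIntegralityRatio
      (fun I : ConnTInstance.{u, v} => I.G.double.polyP I.T ∩ I.G.double.polyQ I.T) (3 / 2) := by
  refine ⟨fun α β G T _ hV hE hG hT _ => Graph.integerPoints_polyP_inter_polyQ hV hE hG.1 hT,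
    fun I => ⟨I.exists_isUnitMin_integerPoints, ?_⟩, ?_, fun r hr => ?_⟩
  · obtain ⟨b, hb⟩ := I.exists_isUnitMin
    exact ⟨b, hb, (zero_lt_one.trans_le (I.one_le_of_isUnitMin hb)).ne'⟩
  · rintro _ ⟨I, a, b, ha, hb, rfl⟩
    exact I.div_le_of_isUnitMin ha hb
  · by_contra hlt
    -- A smaller upper bound `r` is refuted by the cycle with `k = m + 1`, whose ratio is at least
    -- `3/2 - 1/k > r`.
    obtain ⟨m, hm⟩ := exists_nat_one_div_lt (sub_pos.2 (not_le.1 hlt))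
    obtain ⟨a, ha⟩ := (ConnTInstance.ofCycle.{u, v} (m + 1) m.succ_pos).exists_isUnitMin_integerPoints
    obtain ⟨b, hb⟩ := (ConnTInstance.ofCycle.{u, v} (m + 1) m.succ_pos).exists_isUnitMin
    have h1 := ConnTInstance.le_div_of_ofCycle m.succ_pos ha hb
    have h2 := hr ⟨_, a, b, ha, hb, rfl⟩
    push_cast at h1
    linarith
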